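/- Conventions. A polytope $P\subset\mathbb{R}^d$ is the convex hull of a finite set; a face of $P$ is $\emptyset$ or the locus $P^\psi$ where a linear functional $\psi$ attains its maximum on $P$; $\dim\emptyset=-1$; a facet is a face of codimension one; two polytopes are combinatorially equivalent if their face lattices are isomorphic posets. $\operatorname{Lin}F$ is the span of the differences of points of $F$. For real numbers $t_1<\dots<t_n$ with $n>d$, the cyclic polytope $C(n,d)\subset\mathbb{R}^d$ is the convex hull of the points $(t_i,t_i^2,\dots,t_i^d)$, $1\le i\le n$. Let $(v_1,\dots,v_d)$ be a frame (ordered basis) of $\mathbb{R}^d$, $V_k=\operatorname{span}(v_1,\dots,v_k)$, and let $\pi_k:\mathbb{R}^d\to V_k$ fix $v_i$ for $i\le k$ and kill $v_i$ for $i>k$. The frame is $P$-admissible, and $P$ is framed by it, if for every $k$ and every $k$-face $F$ of $P$ the restriction $\pi_k:\operatorname{Lin}F\to V_k$ is an isomorphism; write $\sigma_k^F$ for its inverse and orient $F$ by $\beta_F=\sigma_k^F(v_1)\wedge\dots\wedge\sigma_k^F(v_k)$ (and $\beta_F=1$ if $k=0$). A facet $F$ of a framed polytope $P$ is in the source (resp.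 target) of $P$ if there are $v\in\operatorname{Lin}P$ and a functional $\psi$ with $F=P^\psi$, $\psi(v)<0$ (resp. $\psi(v)>0$), such that $\beta_P$ is a positive multiple of $\beta_F\wedge v$. For $0\le k<\dim P$, the $k$-source (resp. $k$-target) of $P$ is the set of $k$-faces $F$ of $P$ such that $\pi_{k+1}(F)$ is a facet of $\pi_{k+1}(P)$ lying in the source (resp. target) of $\pi_{k+1}(P)$. A cellular $k$-string of $P$ is a sequence $F_1,\dots,F_m$ of faces of $P$ of dimension greater than $k$ such that, for $1\le i<m$, the $k$-target of $F_i$ and the $k$-source of $F_{i+1}$ have a common element; it is a cellular $k$-loop if $F_i=F_j$ for some $i\ne j$. A framed polytope is loop-free if it has no cellular $k$-loop for any $k\ge 0$. Theorem. (1) For all $d\ge 4$, $n\ge\max(6,d+1)$ and all parameters $t_1<\dots<t_n$ there exists a polytope $P\subset\mathbb{R}^d$, combinatorially equivalent to the cyclic polytope $C(n,d)$ with these parameters, such that the canonical frame $(e_1,\dots,e_d)$ is $P$-admissible and $P$, framed by it, has a cellular $k$-loop for some $k$. (2) In contrast, for all $n>d\ge 0$ and all $t_1<\dots<t_n$, the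 canonical frame is admissible for the cyclic polytope $C(n,d)$ itself, and $C(n,d)$ with the canonical frame is loop-free. -/

import Mathlib

namespace FramedPolytope

/-- A polytope is the convex hull of a finite set of points of `ℝ^d`. -/
def IsPolytope {d : ℕ} (P : Set (Fin d → ℝ)) : Prop :=
  ∃ s : Finset (Fin d → ℝ), P = convexHull ℝ (s : Set (Fin d → ℝ))

/-- `F` is a face of `P`: the empty set, or the locus where some linear functional attains its
maximum over `P` (this is what `IsExposed` says). -/
abbrev IsFace {d : ℕ} (P F : Set (Fin d → ℝ)) : Prop := IsExposed ℝ P F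

/-- The face lattice (all faces, including the empty one and `P` itself), ordered by inclusion. -/
abbrev FaceLattice {d : ℕ} (P : Set (Fin d → ℝ)) : Type :=
  {F : Set (Fin d → ℝ) // IsFace P F}

/-- Two polytopes are combinatorially equivalent if their face lattices are isomorphic posets. -/
def CombinatoriallyEquivalent {d e : ℕ} (P : Set (Fin d → ℝ)) (Q : Set (Fin e → ℝ)) : Prop :=
  Nonempty (FaceLattice P ≃o FaceLattice Q)

/-- The linear span of `P`: the span of all differences `x - y` with `x, y ∈ P`. -/
abbrev lin {d : ℕ} (P : Set (Fin d → ℝ)) : Submodule ℝ (Fin d → ℝ) := vectorSpan ℝ P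

open Classical in
/-- The dimension, with the convention `dim ∅ = -1`. -/
noncomputable def dim {d : ℕ} (P : Set (Fin d → ℝ)) : ℤ :=
  if P.Nonempty then (Module.finrank ℝ (lin P) : ℤ) else -1

/-- A facet is a face of codimension one. -/
def IsFacet {d : ℕ} (P F : Set (Fin d → ℝ)) : Prop :=
  IsFace P F ∧ dim F + 1 = dim P

/-- The normal cone of `F` in `P`: the functionals whose maximal locus on `P` is `F`. -/
def normalCone {d : ℕ} (P F : Set (Fin d → ℝ)) : Set (StrongDual ℝ (Fin d → ℝ)) :=
  {ψ | F = {x | x ∈ P ∧ ∀ y ∈ P, ψ y ≤ ψ x}}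

/-- A frame of `ℝ^d` is an ordered basis. -/
abbrev Frame (d : ℕ) : Type := Module.Basis (Fin d) ℝ (Fin d → ℝ)

/-- The canonical frame `(e_1, …, e_d)`. -/
noncomputable def canonicalFrame (d : ℕ) : Frame d := Pi.basisFun ℝ (Fin d)

namespace Frame

variable {d : ℕ} (B : Frame d)

/-- `V_k`, the span of the first `k` vectors of the frame. -/
def flag (k : ℕ) : Submodule ℝ (Fin d → ℝ) :=
  Submodule.span ℝ {v | ∃ i : Fin d, i.val < k ∧ v = B i}

/-- The projection `π_k`, which fixes the first `k` frame vectors and kills the others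
(as an endomorphism of `ℝ^d`, with image `V_k`). -/
noncomputable def proj (k : ℕ) : (Fin d → ℝ) →ₗ[ℝ] (Fin d → ℝ) :=
  B.constr ℝ fun i => if i.val < k then B i else 0

/-- The frame is `P`-admissible: for every `k`-face `F` of `P`, the projection `π_k` restricts to
an isomorphism from `lin F` to `V_k`. -/
def Admissible (P : Set (Fin d → ℝ)) : Prop :=
  ∀ F, IsFace P F → ∀ k : ℕ, dim F = k →
    Set.BijOn (B.proj k) (lin F : Set (Fin d → ℝ)) (B.flag k : Set (Fin d → ℝ))

/-- `P` is a polytope framed by `B`. -/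
def Frames (P : Set (Fin d → ℝ)) : Prop := IsPolytope P ∧ B.Admissible P

/-- The map `σ_k^F : V_k → lin F` inverse to `π_k : lin F → V_k`. -/
noncomputable def lift (k : ℕ) (F : Set (Fin d → ℝ)) : (Fin d → ℝ) → (Fin d → ℝ) :=
  Function.invFunOn (B.proj k) (lin F : Set (Fin d → ℝ))

/-- The generator `σ_k^F(v_1) ∧ ⋯ ∧ σ_k^F(v_k)` of the top exterior power of `lin F`, where
`k = dim F`; it represents the orientation of `F` induced by the frame (and is `1` if `k = 0`). -/
noncomputable def orientation (F : Set (Fin d → ℝ)) : ExteriorAlgebra ℝ (Fin d → ℝ) :=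
  ExteriorAlgebra.ιMulti ℝ (Module.finrank ℝ (lin F)) fun i =>
    B.lift (Module.finrank ℝ (lin F)) F
      (B (Fin.castLE ((Submodule.finrank_le _).trans_eq (Module.finrank_fin_fun ℝ)) i))

/-- Two generators define the same orientation: they differ by a positive scalar. -/
def SameOrientation (β β' : ExteriorAlgebra ℝ (Fin d → ℝ)) : Prop :=
  ∃ c : ℝ, 0 < c ∧ β = c • β'

/-- The source of `P`: the facets whose orientation can be completed to that of `P` by wedging on
the right with an inner-pointing vector. -/
def source (P : Set (Fin d → ℝ)) : Set (Set (Fin d → ℝ)) :=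
  {F | IsFacet P F ∧ ∃ v ∈ lin P, ∃ ψ ∈ normalCone P F, ψ v < 0 ∧
    SameOrientation (B.orientation P) (B.orientation F * ExteriorAlgebra.ι ℝ v)}

/-- The target of `P`: the same with an outer-pointing vector. -/
def target (P : Set (Fin d → ℝ)) : Set (Set (Fin d → ℝ)) :=
  {F | IsFacet P F ∧ ∃ v ∈ lin P, ∃ ψ ∈ normalCone P F, 0 < ψ v ∧
    SameOrientation (B.orientation P) (B.orientation F * ExteriorAlgebra.ι ℝ v)}

/-- The `k`-boundary of `P`: the `k`-faces projected by `π_{k+1}` to facets of `π_{k+1}(P)`. -/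
def kBoundary (k : ℕ) (P : Set (Fin d → ℝ)) : Set (Set (Fin d → ℝ)) :=
  {F | IsFace P F ∧ dim F = k ∧ IsFacet (B.proj (k + 1) '' P) (B.proj (k + 1) '' F)}

/-- The `k`-source of `P`. -/
def kSource (k : ℕ) (P : Set (Fin d → ℝ)) : Set (Set (Fin d → ℝ)) :=
  {F | F ∈ B.kBoundary k P ∧ B.proj (k + 1) '' F ∈ B.source (B.proj (k + 1) '' P)}

/-- The `k`-target of `P`. -/
def kTarget (k : ℕ) (P : Set (Fin d → ℝ)) : Set (Set (Fin d → ℝ)) :=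
  {F | F ∈ B.kBoundary k P ∧ B.proj (k + 1) '' F ∈ B.target (B.proj (k + 1) '' P)}

/-- `F_1, …, F_m` is a cellular `k`-string of `P`: faces of dimension greater than `k` such that
the `k`-target of each one meets the `k`-source of the next one. -/
def IsCellularString (k : ℕ) (P : Set (Fin d → ℝ)) {m : ℕ} (F : Fin m → Set (Fin d → ℝ)) : Prop :=
  (∀ i, IsFace P (F i) ∧ (k : ℤ) < dim (F i)) ∧
    ∀ i j : Fin m, i.val + 1 = j.val → (B.kTarget k (F i) ∩ B.kSource k (F j)).Nonempty

/-- A cellular `k`-loop is a cellular `k`-string with a repeated face. -/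
def IsCellularLoop (k : ℕ) (P : Set (Fin d → ℝ)) {m : ℕ} (F : Fin m → Set (Fin d → ℝ)) : Prop :=
  B.IsCellularString k P F ∧ ∃ i j : Fin m, i ≠ j ∧ F i = F j

/-- `P`, framed by `B`, is loop-free: it has no cellular `k`-loop for any `k`. -/
def LoopFree (P : Set (Fin d → ℝ)) : Prop :=
  ∀ (k m : ℕ) (F : Fin m → Set (Fin d → ℝ)), ¬ B.IsCellularLoop k P F

end Frame

/-- The moment curve `s ↦ (s, s^2, …, s^d)`. -/
def momentCurve (d : ℕ) (s : ℝ) : Fin d → ℝ := fun j => s ^ (j.val + 1)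

/-- The cyclic polytope `C(n,d)` with parameters `t_1, …, t_n`. -/
def cyclicPolytope (d : ℕ) {n : ℕ} (t : Fin n → ℝ) : Set (Fin d → ℝ) :=
  convexHull ℝ (Set.range fun i => momentCurve d (t i))

end FramedPolytope

/-! Sources and targets first lose their exterior algebra. For the canonical frame, a `k`-face
satisfying the projection condition and lying in the `k`-boundary of `F` is in the source or target
according to the sign, on the frame vector of index `k` (counted from `0`), of a functional exposing
its image under `π_{k+1}` (`exists_normal_of_mem_kSource`, `mem_kSource_of_normal` and the target
versions).

Loop-freeness of the cyclic polytope: a functional that factors through `π_{k+1}` restricts to the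
moment curve as a polynomial of degree at most `k + 1`. A `k`-face with `k < d` has exactly `k + 1`
vertices, with label set `J`, so this polynomial minus its maximum is `a ∏ (s - t_j)` over `J`. Thus
`∏ (s - t_j)` is nonnegative on the vertices of `F` for a source face and nonpositive for a target
face. Comparing both kinds at the first label where they differ shows that a sign vector drops
lexicographically from source to target (`signVector_lt`), so a string cannot return to a face.

Existence of loops: for `d ≥ 4`, three vertices of `C(n,d)` span a face as soon as two of their
labels are consecutive. Choose a closed hexagon on six vertices all of whose cyclic triples are of
this kind. If its projection to the plane runs alternately right and left, with each vertex above
the line through the preceding two, then each edge is in the target of one triangle and in the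
source of the next, giving a cellular `1`-loop. Planar coordinates at six nodes are values of
quartics exactly when their fifth divided differences vanish. These are weighted relations with
alternating signs, solvable by a zigzag hexagon under one inequality between weights
(`exists_isZigzag`); three labellings cover all cases. The quartics define a linear map `M` of rank
at most two; `s • id + M`, for generic `s` near `0`, is invertible, keeps the strict planar
inequalities and makes the frame admissible. -/

open Module

namespace FramedPolytope

/-! ### Coordinates, projections and dimension for the canonical frame -/

section Canonical

variable {d : ℕ}

theorem canonicalFrame_apply (i : Fin d) : canonicalFrame d i = Pi.single i 1 := by
  simp [canonicalFrame]

theorem canonicalFrame_proj_apply (k : ℕ) (x : Fin d → ℝ) (i : Fin d) :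
    (canonicalFrame d).proj k x i = if i.val < k then x i else 0 := by
  rw [Frame.proj, Basis.constr_apply_fintype]
  simp only [canonicalFrame, Pi.basisFun_equivFun, LinearEquiv.refl_apply, Pi.basisFun_apply,
    Finset.sum_apply, Pi.smul_apply, smul_eq_mul]
  rw [Finset.sum_eq_single i]
  · split_ifs <;> simp
  · intro j _ hj
    split_ifs <;> simp [hj.symm]
  · simp

theorem mem_canonicalFrame_flag {k : ℕ} {x : Fin d → ℝ} :
    x ∈ (canonicalFrame d).flag k ↔ ∀ i : Fin d, k ≤ i.val → x i = 0 := by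
  constructor
  · intro hx
    induction hx using Submodule.span_induction with
    | mem v hv =>
      obtain ⟨j, hj, rfl⟩ := hv
      intro i hi
      rw [canonicalFrame_apply, Pi.single_apply, if_neg]
      rintro rfl
      omega
    | zero => simp
    | add x y _ _ hx hy => intro i hi; simp [hx i hi, hy i hi]
    | smul a x _ hx => intro i hi; simp [hx i hi]
  · intro h
    rw [← (canonicalFrame d).sum_repr x]
    refine Submodule.sum_mem _ fun i _ => ?_
    by_cases hi : i.val < k
    · exact Submodule.smul_mem _ _ (Submodule.subset_span ⟨i, hi, rfl⟩)
    · have : (canonicalFrame d).repr x i = 0 := by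
        simpa [canonicalFrame] using h i (not_lt.1 hi)
      simp [this]

theorem canonicalFrame_proj_mem_flag (k : ℕ) (x : Fin d → ℝ) :
    (canonicalFrame d).proj k x ∈ (canonicalFrame d).flag k := by
  rw [mem_canonicalFrame_flag]
  intro i hi
  rw [canonicalFrame_proj_apply, if_neg (not_lt.2 hi)]

theorem canonicalFrame_proj_eq_self {k : ℕ} {x : Fin d → ℝ}
    (hx : x ∈ (canonicalFrame d).flag k) : (canonicalFrame d).proj k x = x := by
  ext i
  rw [canonicalFrame_proj_apply]
  split_ifs with h
  · rfl
  · exact (mem_canonicalFrame_flag.1 hx i (not_lt.1 h)).symm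

theorem canonicalFrame_proj_proj {k l : ℕ} (h : k ≤ l) (x : Fin d → ℝ) :
    (canonicalFrame d).proj k ((canonicalFrame d).proj l x) = (canonicalFrame d).proj k x := by
  ext i
  simp only [canonicalFrame_proj_apply]
  split_ifs <;> first | rfl | omega

theorem flag_eq_span_range {k : ℕ} (hk : k ≤ d) (B : Frame d) :
    B.flag k = Submodule.span ℝ (Set.range fun i : Fin k => B (Fin.castLE hk i)) := by
  rw [Frame.flag]
  congr 1
  ext v
  constructor
  · rintro ⟨i, hi, rfl⟩
    exact ⟨⟨i, hi⟩, rfl⟩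
  · rintro ⟨i, rfl⟩
    exact ⟨Fin.castLE hk i, i.2, rfl⟩

theorem finrank_flag {k : ℕ} (hk : k ≤ d) (B : Frame d) : finrank ℝ (B.flag k) = k := by
  rw [flag_eq_span_range hk, finrank_span_eq_card]
  · simp
  · exact B.linearIndependent.comp _ (Fin.castLE_injective hk)

theorem vectorSpan_convexHull (s : Set (Fin d → ℝ)) :
    vectorSpan ℝ (convexHull ℝ s) = vectorSpan ℝ s := by
  rw [← direction_affineSpan, affineSpan_convexHull, direction_affineSpan]

theorem lin_image (f : (Fin d → ℝ) →ₗ[ℝ] (Fin d → ℝ)) (s : Set (Fin d → ℝ)) :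
    lin (f '' s) = (lin s).map f :=
  (AffineMap.map_vectorSpan f.toAffineMap).symm

theorem dim_of_nonempty {s : Set (Fin d → ℝ)} (hs : s.Nonempty) :
    dim s = finrank ℝ (lin s) := by
  rw [dim, if_pos hs]

theorem nonempty_of_dim_eq {s : Set (Fin d → ℝ)} {k : ℕ} (h : dim s = k) : s.Nonempty := by
  by_contra hs
  rw [dim, if_neg hs] at h
  omega

theorem finrank_of_dim_eq {s : Set (Fin d → ℝ)} {k : ℕ} (h : dim s = k) :
    finrank ℝ (lin s) = k := by
  rw [dim_of_nonempty (nonempty_of_dim_eq h)] at h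
  exact_mod_cast h

/-- A linear functional is constant on the locus where it attains its maximum. -/
theorem apply_eq_zero_of_mem_lin {ψ : (Fin d → ℝ) →ₗ[ℝ] ℝ} {S : Set (Fin d → ℝ)}
    (h : ∀ x ∈ S, ∀ y ∈ S, ψ x = ψ y) {v : Fin d → ℝ} (hv : v ∈ lin S) : ψ v = 0 := by
  have : lin S ≤ LinearMap.ker ψ := by
    refine Submodule.span_le.2 ?_
    rintro _ ⟨x, hx, y, hy, rfl⟩
    simp [h x hx y hy]
  exact this hv

end Canonical

/-! ### Decomposable elements of the exterior algebra -/

section Orientation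

variable {d : ℕ}

theorem orientation_eq (B : Frame d) {F : Set (Fin d → ℝ)} {k : ℕ} (hk : k ≤ d)
    (h : finrank ℝ (lin F) = k) :
    B.orientation F = ExteriorAlgebra.ιMulti ℝ k fun i => B.lift k F (B (Fin.castLE hk i)) := by
  subst h
  rfl

theorem ιMulti_mul_ι {R M : Type*} [CommRing R] [AddCommGroup M] [Module R M] {k : ℕ}
    (w : Fin k → M) (v : M) :
    ExteriorAlgebra.ιMulti R k w * ExteriorAlgebra.ι R v =
      ExteriorAlgebra.ιMulti R (k + 1) (Fin.snoc w v : Fin (k + 1) → M) := by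
  rw [ExteriorAlgebra.ιMulti_apply, ExteriorAlgebra.ιMulti_apply, List.ofFn_succ']
  simp

/-- Wedging on the right with `e` is insensitive to adding multiples of `e` to the factors. -/
theorem ιMulti_add_smul_mul_ι {R M : Type*} [CommRing R] [AddCommGroup M] [Module R M] {k : ℕ}
    (w : Fin k → M) (c : Fin k → R) (e : M) :
    ExteriorAlgebra.ιMulti R k (fun i => w i + c i • e) * ExteriorAlgebra.ι R e =
      ExteriorAlgebra.ιMulti R k w * ExteriorAlgebra.ι R e := by
  have key : ∀ S : Finset (Fin k),
      ExteriorAlgebra.ιMulti R k (fun i => if i ∈ S then w i + c i • e else w i) *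
        ExteriorAlgebra.ι R e = ExteriorAlgebra.ιMulti R k w * ExteriorAlgebra.ι R e := by
    intro S
    induction S using Finset.induction with
    | empty => simp
    | insert a S ha ih =>
      rw [← ih]
      set u : Fin k → M := fun i => if i ∈ S then w i + c i • e else w i with hu
      have h1 : (fun i => if i ∈ insert a S then w i + c i • e else w i) =
          Function.update u a (u a + c a • e) := by
        ext i
        by_cases hi : i = a
        · subst hi; simp [hu, ha]
        · simp [hu, hi]
      rw [h1, AlternatingMap.map_update_add, AlternatingMap.map_update_smul,
        Function.update_eq_self, add_mul, smul_mul_assoc, ιMulti_mul_ι (Function.update u a e),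
        AlternatingMap.map_eq_zero_of_eq _ _ (i := a.castSucc) (j := Fin.last k) (by simp)
          (Fin.castSucc_lt_last a).ne]
      simp
  simpa using key Finset.univ

theorem ιMulti_ne_zero_of_linearIndependent {k : ℕ} {w : Fin k → (Fin d → ℝ)}
    (hw : LinearIndependent ℝ w) : ExteriorAlgebra.ιMulti ℝ k w ≠ 0 := by
  obtain ⟨g, hg⟩ := LinearMap.exists_leftInverse_of_injective (Fintype.linearCombination ℝ w)
    (LinearMap.ker_eq_bot.2 hw.fintypeLinearCombination_injective)
  have hgw : ∀ i, g (w i) = Pi.single i 1 := by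
    intro i
    have := LinearMap.congr_fun hg (Pi.single i 1)
    simpa [Fintype.linearCombination_apply_single] using this
  -- The determinant pulled back along the left inverse `g`, placed in degree `k` and zero in all
  -- others; its extension to the exterior algebra takes the value `1` on the wedge of `w`.
  let f : ∀ i : ℕ, (Fin d → ℝ) [⋀^Fin i]→ₗ[ℝ] ℝ := fun i =>
    if h : i = k then
      ((Pi.basisFun ℝ (Fin k)).det.compLinearMap g).domDomCongr (finCongr h.symm) else 0
  intro h0
  have h1 := ExteriorAlgebra.liftAlternating_apply_ιMulti f w
  rw [h0, map_zero] at h1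
  simp only [f, dif_pos] at h1
  have h2 : (Pi.basisFun ℝ (Fin k)).det (Pi.basisFun ℝ (Fin k)) = 0 := by
    rw [h1]
    simp only [AlternatingMap.domDomCongr_apply, AlternatingMap.compLinearMap_apply]
    congr 1
    ext1 i
    simp [hgw]
  rw [Basis.det_self] at h2
  exact one_ne_zero h2

end Orientation

/-! ### Sources and targets through the sign of a normal functional -/

section Source

variable {d : ℕ}

theorem lift_mem_and_proj_lift {B : Frame d} {k : ℕ} {S : Set (Fin d → ℝ)}
    (h : Set.SurjOn (B.proj k) (lin S) (B.flag k)) {v : Fin d → ℝ} (hv : v ∈ B.flag k) :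
    B.lift k S v ∈ lin S ∧ B.proj k (B.lift k S v) = v :=
  ⟨Function.invFunOn_mem (h hv), Function.invFunOn_eq (h hv)⟩

theorem lin_proj_image_le_flag (k : ℕ) (P : Set (Fin d → ℝ)) :
    lin ((canonicalFrame d).proj k '' P) ≤ (canonicalFrame d).flag k := by
  rw [lin_image, Submodule.map_le_iff_le_comap]
  intro x _
  exact canonicalFrame_proj_mem_flag k x

theorem orientation_of_lin_eq_flag {k : ℕ} (hk : k ≤ d) {F : Set (Fin d → ℝ)}
    (hF : lin F = (canonicalFrame d).flag k) :
    (canonicalFrame d).orientation F =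
      ExteriorAlgebra.ιMulti ℝ k fun i => canonicalFrame d (Fin.castLE hk i) := by
  rw [orientation_eq _ hk (by rw [hF, finrank_flag hk])]
  congr 1
  ext1 i
  have hi : canonicalFrame d (Fin.castLE hk i) ∈ (canonicalFrame d).flag k :=
    Submodule.subset_span ⟨_, i.2, rfl⟩
  have hsurj : Set.SurjOn ((canonicalFrame d).proj k) (lin F) ((canonicalFrame d).flag k) :=
    fun x hx => ⟨x, hF ▸ hx, canonicalFrame_proj_eq_self hx⟩
  obtain ⟨h1, h2⟩ := lift_mem_and_proj_lift hsurj hi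
  rw [hF] at h1
  rwa [canonicalFrame_proj_eq_self h1] at h2

theorem orientation_ne_zero_of_lin_eq_flag {k : ℕ} (hk : k ≤ d) {F : Set (Fin d → ℝ)}
    (hF : lin F = (canonicalFrame d).flag k) : (canonicalFrame d).orientation F ≠ 0 := by
  rw [orientation_of_lin_eq_flag hk hF]
  exact ιMulti_ne_zero_of_linearIndependent
    ((canonicalFrame d).linearIndependent.comp _ (Fin.castLE_injective hk))

/-- Completing the orientation of a hypersurface of `V_{k+1}` that projects isomorphically to `V_k`:
the wedge with `v` is measured by the component of `v` along the next frame vector. -/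
theorem exists_orientation_mul_ι {k : ℕ} (hk : k < d) {S F : Set (Fin d → ℝ)}
    (hS : finrank ℝ (lin S) = k) (hSle : lin S ≤ (canonicalFrame d).flag (k + 1))
    (hSsurj : Set.SurjOn ((canonicalFrame d).proj k) (lin S) ((canonicalFrame d).flag k))
    (hF : lin F = (canonicalFrame d).flag (k + 1)) :
    ∃ b : (Fin d → ℝ) → ℝ, b (canonicalFrame d ⟨k, hk⟩) = 1 ∧
      ∀ v ∈ (canonicalFrame d).flag (k + 1),
        (canonicalFrame d).orientation S * ExteriorAlgebra.ι ℝ v =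
          b v • (canonicalFrame d).orientation F ∧
        ∀ ψ : (Fin d → ℝ) →ₗ[ℝ] ℝ, (∀ u ∈ lin S, ψ u = 0) →
          ψ v = b v * ψ (canonicalFrame d ⟨k, hk⟩) := by
  set e := canonicalFrame d ⟨k, hk⟩ with he
  set w : Fin k → (Fin d → ℝ) := fun i =>
    (canonicalFrame d).lift k S (canonicalFrame d (Fin.castLE hk.le i)) with hw
  have hwS : ∀ i, w i ∈ lin S ∧
      (canonicalFrame d).proj k (w i) = canonicalFrame d (Fin.castLE hk.le i) := fun i =>
    lift_mem_and_proj_lift hSsurj (Submodule.subset_span ⟨_, i.2, rfl⟩)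
  have hdecomp : ∀ x ∈ (canonicalFrame d).flag (k + 1),
      x = (canonicalFrame d).proj k x + x ⟨k, hk⟩ • e := by
    intro x hx
    ext i
    rw [Pi.add_apply, canonicalFrame_proj_apply, Pi.smul_apply, he, canonicalFrame_apply,
      Pi.single_apply]
    rcases lt_trichotomy i.val k with h | h | h
    · simp [h, Fin.ext_iff, h.ne]
    · simp [h, Fin.ext_iff]
      congr 1
      exact Fin.ext h
    · simp [h.not_gt, Fin.ext_iff, h.ne', mem_canonicalFrame_flag.1 hx i h]
  have hproj : ∀ x : Fin d → ℝ, (canonicalFrame d).proj k x =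
      ∑ i : Fin k, x (Fin.castLE hk.le i) • canonicalFrame d (Fin.castLE hk.le i) := by
    intro x
    ext j
    rw [canonicalFrame_proj_apply, Finset.sum_apply]
    simp only [Pi.smul_apply, canonicalFrame_apply, Pi.single_apply, smul_eq_mul, mul_ite, mul_one,
      mul_zero]
    split_ifs with h
    · rw [Finset.sum_eq_single ⟨j, h⟩]
      · simp
      · intro i _ hi
        rw [if_neg]
        rintro rfl
        exact hi rfl
      · simp
    · refine (Finset.sum_eq_zero fun i _ => ?_).symm
      rw [if_neg]
      rintro rfl
      exact h i.2
  have hwe : ∀ i, w i = canonicalFrame d (Fin.castLE hk.le i) + w i ⟨k, hk⟩ • e := fun i => by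
    conv_lhs => rw [hdecomp _ (hSle (hwS i).1), (hwS i).2]
  have hSor : (canonicalFrame d).orientation S = ExteriorAlgebra.ιMulti ℝ k w :=
    orientation_eq _ hk.le hS
  have hFor : ExteriorAlgebra.ιMulti ℝ k w * ExteriorAlgebra.ι ℝ e =
      (canonicalFrame d).orientation F := by
    rw [orientation_of_lin_eq_flag hk hF]
    have h1 : w = fun i => canonicalFrame d (Fin.castLE hk.le i) + w i ⟨k, hk⟩ • e := funext hwe
    rw [h1, ιMulti_add_smul_mul_ι, ιMulti_mul_ι]
    congr 1
    ext1 i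
    refine Fin.lastCases ?_ (fun i => ?_) i
    · rw [Fin.snoc_last]; rfl
    · rw [Fin.snoc_castSucc]; rfl
  -- The coefficient of `e` when `v` is expanded in the `w i` and `e`, found from `w i = e_i + (w
  -- i)_k • e`. The `w i` contribute nothing to the wedge with the orientation of `S`, nor to a
  -- functional vanishing on `lin S`.
  let b : (Fin d → ℝ) → ℝ := fun v =>
    v ⟨k, hk⟩ - ∑ i : Fin k, v (Fin.castLE hk.le i) * w i ⟨k, hk⟩
  have hv : ∀ v ∈ (canonicalFrame d).flag (k + 1),
      v = ∑ i : Fin k, v (Fin.castLE hk.le i) • w i + b v • e := by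
    intro v hv
    have h1 : ∑ i : Fin k, v (Fin.castLE hk.le i) • w i = (canonicalFrame d).proj k v +
        (∑ i : Fin k, v (Fin.castLE hk.le i) * w i ⟨k, hk⟩) • e := by
      rw [hproj, Finset.sum_smul, ← Finset.sum_add_distrib]
      refine Finset.sum_congr rfl fun i _ => ?_
      conv_lhs => rw [hwe i]
      rw [smul_add, smul_smul]
    rw [h1, add_assoc, ← add_smul, add_sub_cancel]
    exact hdecomp v hv
  refine ⟨b, ?_, fun v hvf => ⟨?_, fun ψ hψ => ?_⟩⟩
  · simp only [b, he, canonicalFrame_apply, Pi.single_eq_same]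
    rw [Finset.sum_eq_zero, sub_zero]
    intro i _
    rw [Pi.single_eq_of_ne, zero_mul]
    simp [Fin.ext_iff, i.2.ne]
  · have hz : ∀ i, ExteriorAlgebra.ιMulti ℝ k w * ExteriorAlgebra.ι ℝ (w i) = 0 := fun i => by
      rw [ιMulti_mul_ι]
      exact AlternatingMap.map_eq_zero_of_eq _ _ (i := i.castSucc) (j := Fin.last k) (by simp)
        (Fin.castSucc_lt_last i).ne
    conv_lhs => rw [hv v hvf]
    rw [hSor, map_add, map_sum, mul_add, Finset.mul_sum, map_smul, mul_smul_comm, hFor,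
      Finset.sum_eq_zero, zero_add]
    intro i _
    rw [map_smul, mul_smul_comm, hz, smul_zero]
  · conv_lhs => rw [hv v hvf]
    rw [map_add, map_sum, map_smul, smul_eq_mul, Finset.sum_eq_zero, zero_add]
    intro i _
    rw [map_smul, hψ _ (hwS i).1, smul_zero]

theorem proj_image_surjOn {k : ℕ} {S : Set (Fin d → ℝ)}
    (h : Set.SurjOn ((canonicalFrame d).proj k) (lin S) ((canonicalFrame d).flag k)) :
    Set.SurjOn ((canonicalFrame d).proj k) (lin ((canonicalFrame d).proj (k + 1) '' S))
      ((canonicalFrame d).flag k) := by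
  intro y hy
  obtain ⟨x, hx, rfl⟩ := h hy
  refine ⟨(canonicalFrame d).proj (k + 1) x, ?_, canonicalFrame_proj_proj (Nat.le_succ k) x⟩
  rw [lin_image]
  exact Submodule.mem_map_of_mem hx

theorem finrank_lin_proj_image {k : ℕ} (hk : k ≤ d) {S : Set (Fin d → ℝ)}
    (hS : finrank ℝ (lin S) = k)
    (h : Set.SurjOn ((canonicalFrame d).proj k) (lin S) ((canonicalFrame d).flag k)) :
    finrank ℝ (lin ((canonicalFrame d).proj (k + 1) '' S)) = k := by
  refine le_antisymm ?_ ?_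
  · rw [lin_image]
    exact (Submodule.finrank_map_le _ _).trans hS.le
  · have h2 : (canonicalFrame d).flag k ≤
        (lin ((canonicalFrame d).proj (k + 1) '' S)).map ((canonicalFrame d).proj k) := by
      intro y hy
      obtain ⟨x, hx, rfl⟩ := proj_image_surjOn h hy
      exact Submodule.mem_map_of_mem hx
    calc k = finrank ℝ ((canonicalFrame d).flag k) := (finrank_flag hk _).symm
      _ ≤ _ := Submodule.finrank_mono h2
      _ ≤ _ := Submodule.finrank_map_le _ _

theorem eq_on_of_mem_normalCone {P F : Set (Fin d → ℝ)} {ψ : StrongDual ℝ (Fin d → ℝ)}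
    (h : ψ ∈ normalCone P F) : ∀ u ∈ lin F, (ψ : (Fin d → ℝ) →ₗ[ℝ] ℝ) u = 0 := by
  intro u hu
  refine apply_eq_zero_of_mem_lin (S := F) ?_ hu
  intro x hx y hy
  change F = _ at h
  rw [h] at hx hy
  exact le_antisymm (hy.2 _ hx.1) (hx.2 _ hy.1)

/-- The completing vector `v` is arbitrary in the definition of source and target. The orientation
condition says that its coefficient along the new frame vector, modulo `lin` of the projected face,
is positive, so `v` may be traded for that frame vector without changing the sign of `ψ`. -/
theorem exists_normal_of_mem_kBoundary {k : ℕ} (hk : k < d) {F S : Set (Fin d → ℝ)}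
    (hSsurj : Set.SurjOn ((canonicalFrame d).proj k) (lin S) ((canonicalFrame d).flag k))
    (h : S ∈ (canonicalFrame d).kBoundary k F) {ψ : StrongDual ℝ (Fin d → ℝ)}
    (hψ : ψ ∈ normalCone ((canonicalFrame d).proj (k + 1) '' F)
      ((canonicalFrame d).proj (k + 1) '' S)) {v : Fin d → ℝ}
    (hv : v ∈ lin ((canonicalFrame d).proj (k + 1) '' F))
    (hor : Frame.SameOrientation
      ((canonicalFrame d).orientation ((canonicalFrame d).proj (k + 1) '' F))
      ((canonicalFrame d).orientation ((canonicalFrame d).proj (k + 1) '' S) *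
        ExteriorAlgebra.ι ℝ v)) :
    ∃ b : ℝ, 0 < b ∧ ψ v = b * ψ (canonicalFrame d ⟨k, hk⟩) := by
  obtain ⟨_, hdim, hfacet⟩ := h
  have hSk := finrank_lin_proj_image hk.le (finrank_of_dim_eq hdim) hSsurj
  have hne : ((canonicalFrame d).proj (k + 1) '' S).Nonempty :=
    (nonempty_of_dim_eq hdim).image _
  have hFk : dim ((canonicalFrame d).proj (k + 1) '' F) = (k + 1 : ℕ) := by
    rw [← hfacet.2, dim_of_nonempty hne, hSk]
    norm_cast
  have hlinF : lin ((canonicalFrame d).proj (k + 1) '' F) = (canonicalFrame d).flag (k + 1) := by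
    refine Submodule.eq_of_le_of_finrank_eq (lin_proj_image_le_flag _ _) ?_
    rw [finrank_of_dim_eq hFk, finrank_flag hk]
  obtain ⟨b, _, hb⟩ := exists_orientation_mul_ι hk hSk (lin_proj_image_le_flag _ _)
    (proj_image_surjOn hSsurj) hlinF
  obtain ⟨h1, h2⟩ := hb v (hlinF ▸ hv)
  refine ⟨b v, ?_, h2 (ψ : (Fin d → ℝ) →ₗ[ℝ] ℝ) (eq_on_of_mem_normalCone hψ)⟩
  obtain ⟨c, hc, hor⟩ := hor
  rw [h1, smul_smul] at hor
  -- The orientation of the projected `F` is nonzero, so `c * b v = 1`, and `b v` inherits the sign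
  -- of `c`.
  have h3 : (1 - c * b v) •
      (canonicalFrame d).orientation ((canonicalFrame d).proj (k + 1) '' F) = 0 := by
    rw [sub_smul, one_smul, ← hor, sub_self]
  rcases smul_eq_zero.1 h3 with h4 | h4
  · by_contra hb
    nlinarith [mul_nonneg hc.le (sub_nonneg.2 (not_lt.1 hb))]
  · exact absurd h4 (orientation_ne_zero_of_lin_eq_flag hk hlinF)

theorem exists_normal_of_mem_kSource {k : ℕ} (hk : k < d) {F S : Set (Fin d → ℝ)}
    (hSsurj : Set.SurjOn ((canonicalFrame d).proj k) (lin S) ((canonicalFrame d).flag k))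
    (h : S ∈ (canonicalFrame d).kSource k F) :
    ∃ ψ ∈ normalCone ((canonicalFrame d).proj (k + 1) '' F)
      ((canonicalFrame d).proj (k + 1) '' S), ψ (canonicalFrame d ⟨k, hk⟩) < 0 := by
  obtain ⟨hb, _, v, hv, ψ, hψ, hneg, hor⟩ := h
  obtain ⟨b, hb0, hbv⟩ := exists_normal_of_mem_kBoundary hk hSsurj hb hψ hv hor
  refine ⟨ψ, hψ, ?_⟩
  rw [hbv] at hneg
  exact (pos_iff_neg_of_mul_neg hneg).1 hb0

theorem exists_normal_of_mem_kTarget {k : ℕ} (hk : k < d) {F S : Set (Fin d → ℝ)}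
    (hSsurj : Set.SurjOn ((canonicalFrame d).proj k) (lin S) ((canonicalFrame d).flag k))
    (h : S ∈ (canonicalFrame d).kTarget k F) :
    ∃ ψ ∈ normalCone ((canonicalFrame d).proj (k + 1) '' F)
      ((canonicalFrame d).proj (k + 1) '' S), 0 < ψ (canonicalFrame d ⟨k, hk⟩) := by
  obtain ⟨hb, _, v, hv, ψ, hψ, hpos, hor⟩ := h
  obtain ⟨b, hb0, hbv⟩ := exists_normal_of_mem_kBoundary hk hSsurj hb hψ hv hor
  refine ⟨ψ, hψ, ?_⟩
  rw [hbv] at hpos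
  exact (pos_iff_pos_of_mul_pos hpos).1 hb0

/-- A face cut out by a functional on `V_{k+1}` and projecting isomorphically to `V_k` lies in the
`k`-boundary. -/
theorem mem_kBoundary_of_normal {k : ℕ} (hk : k < d) {F S : Set (Fin d → ℝ)}
    (hS : dim S = k) (hFS : ¬ F ⊆ S)
    (hSsurj : Set.SurjOn ((canonicalFrame d).proj k) (lin S) ((canonicalFrame d).flag k))
    {ψ : StrongDual ℝ (Fin d → ℝ)}
    (hψ : ∀ x, x ∈ S ↔ x ∈ F ∧ ∀ y ∈ F, ψ ((canonicalFrame d).proj (k + 1) y) ≤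
      ψ ((canonicalFrame d).proj (k + 1) x)) :
    S ∈ (canonicalFrame d).kBoundary k F ∧
    ψ ∈ normalCone ((canonicalFrame d).proj (k + 1) '' F)
      ((canonicalFrame d).proj (k + 1) '' S) ∧
    lin ((canonicalFrame d).proj (k + 1) '' F) = (canonicalFrame d).flag (k + 1) := by
  have hcone : ψ ∈ normalCone ((canonicalFrame d).proj (k + 1) '' F)
      ((canonicalFrame d).proj (k + 1) '' S) := by
    ext x
    constructor
    · rintro ⟨x, hx, rfl⟩
      refine ⟨⟨x, ((hψ x).1 hx).1, rfl⟩, ?_⟩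
      rintro _ ⟨y, hy, rfl⟩
      exact ((hψ x).1 hx).2 y hy
    · rintro ⟨⟨x, hx, rfl⟩, h⟩
      exact ⟨x, (hψ x).2 ⟨hx, fun y hy => h _ ⟨y, hy, rfl⟩⟩, rfl⟩
  have hSne := nonempty_of_dim_eq hS
  have hSk := finrank_lin_proj_image hk.le (finrank_of_dim_eq hS) hSsurj
  have hsub : S ⊆ F := fun x hx => ((hψ x).1 hx).1
  have hlin : lin ((canonicalFrame d).proj (k + 1) '' F) = (canonicalFrame d).flag (k + 1) := by
    refine Submodule.eq_of_le_of_finrank_le (lin_proj_image_le_flag _ _) ?_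
    rw [finrank_flag hk]
    -- Equal spans would make `ψ` constant on the projection of `F`, putting all of `F` in the
    -- maximal locus `S`. So the span grows from dimension `k` and must fill `V_{k+1}`.
    have hlt : lin ((canonicalFrame d).proj (k + 1) '' S) <
        lin ((canonicalFrame d).proj (k + 1) '' F) := by
      refine lt_of_le_of_ne (vectorSpan_mono ℝ (Set.image_mono hsub)) fun heq => ?_
      obtain ⟨y, hyF, hyS⟩ := Set.not_subset.1 hFS
      obtain ⟨x, hx⟩ := hSne
      have hmem : (canonicalFrame d).proj (k + 1) y - (canonicalFrame d).proj (k + 1) x ∈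
          lin ((canonicalFrame d).proj (k + 1) '' F) :=
        vsub_mem_vectorSpan ℝ ⟨y, hyF, rfl⟩ ⟨x, hsub hx, rfl⟩
      rw [← heq] at hmem
      have h0 := eq_on_of_mem_normalCone hcone _ hmem
      rw [map_sub, sub_eq_zero] at h0
      refine hyS ((hψ y).2 ⟨hyF, fun z hz => ?_⟩)
      exact (((hψ x).1 hx).2 z hz).trans_eq h0.symm
    have := Submodule.finrank_lt_finrank_of_lt hlt
    omega
  refine ⟨⟨fun _ => ⟨ψ.comp (LinearMap.toContinuousLinearMap ((canonicalFrame d).proj (k + 1))),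
    ?_⟩, hS, fun _ => ⟨ψ, hcone⟩, ?_⟩, hcone, hlin⟩
  · ext x
    exact hψ x
  · rw [dim_of_nonempty (hSne.image _), dim_of_nonempty ((hSne.mono hsub).image _), hSk, hlin,
      finrank_flag hk]
    norm_cast

theorem sameOrientation_of_normal {k : ℕ} (hk : k < d) {F S : Set (Fin d → ℝ)}
    (hS : dim S = k)
    (hSsurj : Set.SurjOn ((canonicalFrame d).proj k) (lin S) ((canonicalFrame d).flag k))
    (hF : lin ((canonicalFrame d).proj (k + 1) '' F) = (canonicalFrame d).flag (k + 1)) :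
    Frame.SameOrientation
      ((canonicalFrame d).orientation ((canonicalFrame d).proj (k + 1) '' F))
      ((canonicalFrame d).orientation ((canonicalFrame d).proj (k + 1) '' S) *
        ExteriorAlgebra.ι ℝ (canonicalFrame d ⟨k, hk⟩)) := by
  obtain ⟨b, hb1, hb⟩ := exists_orientation_mul_ι hk
    (finrank_lin_proj_image hk.le (finrank_of_dim_eq hS) hSsurj) (lin_proj_image_le_flag _ _)
    (proj_image_surjOn hSsurj) hF
  refine ⟨1, one_pos, ?_⟩
  rw [(hb _ (Submodule.subset_span ⟨⟨k, hk⟩, Nat.lt_succ_self k, rfl⟩)).1, hb1, one_smul, one_smul]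

theorem mem_kSource_of_normal {k : ℕ} (hk : k < d) {F S : Set (Fin d → ℝ)}
    (hS : dim S = k) (hFS : ¬ F ⊆ S)
    (hSsurj : Set.SurjOn ((canonicalFrame d).proj k) (lin S) ((canonicalFrame d).flag k))
    {ψ : StrongDual ℝ (Fin d → ℝ)}
    (hψ : ∀ x, x ∈ S ↔ x ∈ F ∧ ∀ y ∈ F, ψ ((canonicalFrame d).proj (k + 1) y) ≤
      ψ ((canonicalFrame d).proj (k + 1) x))
    (hneg : ψ (canonicalFrame d ⟨k, hk⟩) < 0) :
    S ∈ (canonicalFrame d).kSource k F := by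
  obtain ⟨hb, hcone, hlin⟩ := mem_kBoundary_of_normal hk hS hFS hSsurj hψ
  refine ⟨hb, hb.2.2, canonicalFrame d ⟨k, hk⟩, ?_, ψ, hcone, hneg,
    sameOrientation_of_normal hk hS hSsurj hlin⟩
  rw [hlin]
  exact Submodule.subset_span ⟨⟨k, hk⟩, Nat.lt_succ_self k, rfl⟩

theorem mem_kTarget_of_normal {k : ℕ} (hk : k < d) {F S : Set (Fin d → ℝ)}
    (hS : dim S = k) (hFS : ¬ F ⊆ S)
    (hSsurj : Set.SurjOn ((canonicalFrame d).proj k) (lin S) ((canonicalFrame d).flag k))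
    {ψ : StrongDual ℝ (Fin d → ℝ)}
    (hψ : ∀ x, x ∈ S ↔ x ∈ F ∧ ∀ y ∈ F, ψ ((canonicalFrame d).proj (k + 1) y) ≤
      ψ ((canonicalFrame d).proj (k + 1) x))
    (hpos : 0 < ψ (canonicalFrame d ⟨k, hk⟩)) :
    S ∈ (canonicalFrame d).kTarget k F := by
  obtain ⟨hb, hcone, hlin⟩ := mem_kBoundary_of_normal hk hS hFS hSsurj hψ
  refine ⟨hb, hb.2.2, canonicalFrame d ⟨k, hk⟩, ?_, ψ, hcone, hpos,
    sameOrientation_of_normal hk hS hSsurj hlin⟩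
  rw [hlin]
  exact Submodule.subset_span ⟨⟨k, hk⟩, Nat.lt_succ_self k, rfl⟩

end Source

/-! ### Faces of a convex hull and the generators they contain -/

section Faces

variable {d : ℕ} {ι : Type*}

theorem setOf_le_apply_convexHull (p : ι → Fin d → ℝ) (I : Set ι)
    (ψ : (Fin d → ℝ) →ₗ[ℝ] ℝ) {c : ℝ} (hc : ∀ i ∈ I, ψ (p i) ≤ c) :
    {x | x ∈ convexHull ℝ (p '' I) ∧ c ≤ ψ x} = convexHull ℝ (p '' {i | i ∈ I ∧ ψ (p i) = c}) := by
  set C := convexHull ℝ (p '' {i | i ∈ I ∧ ψ (p i) = c})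
  apply Set.Subset.antisymm
  · have hconv : Convex ℝ {x | ψ x ≤ c ∧ (ψ x = c → x ∈ C)} := by
      rintro x ⟨hx1, hx2⟩ y ⟨hy1, hy2⟩ a b ha hb hab
      have hle : ψ (a • x + b • y) ≤ c := by
        rw [map_add, map_smul, map_smul, smul_eq_mul, smul_eq_mul]
        calc a * ψ x + b * ψ y ≤ a * c + b * c := by gcongr
          _ = c := by rw [← add_mul, hab, one_mul]
      refine ⟨hle, fun heq => ?_⟩
      rcases ha.eq_or_lt with rfl | ha
      · rw [zero_add] at hab
        subst hab
        simpa using hy2 (by simpa using heq)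
      rcases hb.eq_or_lt with rfl | hb
      · rw [add_zero] at hab
        subst hab
        simpa using hx2 (by simpa using heq)
      rw [map_add, map_smul, map_smul, smul_eq_mul, smul_eq_mul] at heq
      have h1 : a * (c - ψ x) + b * (c - ψ y) = 0 := by linear_combination c * hab - heq
      have h2 := mul_nonneg ha.le (sub_nonneg.2 hx1)
      have h3 := mul_nonneg hb.le (sub_nonneg.2 hy1)
      have h4 : a * (c - ψ x) = 0 := by linarith
      have h5 : b * (c - ψ y) = 0 := by linarith
      have h6 : ψ x = c := by
        rcases mul_eq_zero.1 h4 with h | h <;> linarith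
      have h7 : ψ y = c := by
        rcases mul_eq_zero.1 h5 with h | h <;> linarith
      exact convex_convexHull ℝ _ (hx2 h6) (hy2 h7) ha.le hb.le hab
    have hsub : p '' I ⊆ {x | ψ x ≤ c ∧ (ψ x = c → x ∈ C)} := by
      rintro _ ⟨i, hi, rfl⟩
      exact ⟨hc i hi, fun h => subset_convexHull ℝ _ ⟨i, ⟨hi, h⟩, rfl⟩⟩
    rintro x ⟨hx, hcx⟩
    obtain ⟨h1, h2⟩ := convexHull_min hsub hconv hx
    exact h2 (le_antisymm h1 hcx)
  · refine convexHull_min ?_ ((convex_convexHull ℝ _).inter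
      (convex_halfSpace_ge (𝕜 := ℝ) ψ.isLinear c))
    rintro _ ⟨i, ⟨hi, h⟩, rfl⟩
    exact ⟨subset_convexHull ℝ _ ⟨i, hi, rfl⟩, h.ge⟩

theorem apply_le_of_mem_convexHull {p : ι → Fin d → ℝ} {I : Set ι}
    {ψ : (Fin d → ℝ) →ₗ[ℝ] ℝ} {c : ℝ} (hc : ∀ i ∈ I, ψ (p i) ≤ c) {x : Fin d → ℝ}
    (hx : x ∈ convexHull ℝ (p '' I)) : ψ x ≤ c := by
  refine convexHull_min ?_ (convex_halfSpace_le (𝕜 := ℝ) ψ.isLinear c) hx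
  rintro _ ⟨i, hi, rfl⟩
  exact hc i hi

/-- The vertices maximizing a functional span the corresponding face. -/
theorem mem_convexHull_argmax_iff (p : ι → Fin d → ℝ) (I : Set ι)
    (ψ : (Fin d → ℝ) →ₗ[ℝ] ℝ) {c : ℝ} (hc : ∀ i ∈ I, ψ (p i) ≤ c)
    (hne : ∃ i ∈ I, ψ (p i) = c) (x : Fin d → ℝ) :
    x ∈ convexHull ℝ (p '' {i | i ∈ I ∧ ψ (p i) = c}) ↔
      x ∈ convexHull ℝ (p '' I) ∧ ∀ y ∈ convexHull ℝ (p '' I), ψ y ≤ ψ x := by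
  rw [← setOf_le_apply_convexHull p I ψ hc]
  constructor
  · rintro ⟨hx, hcx⟩
    exact ⟨hx, fun y hy => (apply_le_of_mem_convexHull hc hy).trans hcx⟩
  · rintro ⟨hx, h⟩
    obtain ⟨i, hi, rfl⟩ := hne
    exact ⟨hx, h _ (subset_convexHull ℝ _ ⟨i, hi, rfl⟩)⟩

theorem isFace_eq_convexHull {p : ι → Fin d → ℝ} {I : Set ι} {G : Set (Fin d → ℝ)}
    (h : IsFace (convexHull ℝ (p '' I)) G) :
    G = convexHull ℝ (p '' {i | i ∈ I ∧ p i ∈ G}) := by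
  rcases G.eq_empty_or_nonempty with rfl | hne
  · simp
  obtain ⟨ψ, hψ⟩ := h hne
  obtain ⟨x₀, hx₀⟩ := hne
  have hx₀' := hx₀
  rw [hψ] at hx₀'
  have hmem : ∀ x, x ∈ G ↔ x ∈ convexHull ℝ (p '' I) ∧ ψ x₀ ≤ ψ x := by
    intro x
    rw [hψ]
    exact ⟨fun hx => ⟨hx.1, hx.2 _ hx₀'.1⟩, fun hx => ⟨hx.1, fun y hy => (hx₀'.2 y hy).trans hx.2⟩⟩
  have hle : ∀ i ∈ I, (ψ : (Fin d → ℝ) →ₗ[ℝ] ℝ) (p i) ≤ ψ x₀ := fun i hi =>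
    hx₀'.2 _ (subset_convexHull ℝ _ ⟨i, hi, rfl⟩)
  have hset : {i | i ∈ I ∧ p i ∈ G} =
      {i | i ∈ I ∧ (ψ : (Fin d → ℝ) →ₗ[ℝ] ℝ) (p i) = ψ x₀} := by
    ext i
    constructor
    · rintro ⟨hi, h⟩
      exact ⟨hi, le_antisymm (hle i hi) ((hmem _).1 h).2⟩
    · rintro ⟨hi, h⟩
      exact ⟨hi, (hmem _).2 ⟨subset_convexHull ℝ _ ⟨i, hi, rfl⟩, h.ge⟩⟩
  rw [hset, ← setOf_le_apply_convexHull p I _ hle]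
  ext x
  exact hmem x

open Classical in
/-- The labels of the points of the family `p` that lie in `F`. -/
noncomputable def labels [Fintype ι] (p : ι → Fin d → ℝ) (F : Set (Fin d → ℝ)) : Finset ι :=
  Finset.univ.filter fun i => p i ∈ F

theorem mem_labels [Fintype ι] {p : ι → Fin d → ℝ} {F : Set (Fin d → ℝ)} {i : ι} :
    i ∈ labels p F ↔ p i ∈ F := by
  simp [labels]

theorem isFace_eq_convexHull_labels [Fintype ι] {p : ι → Fin d → ℝ} {F : Set (Fin d → ℝ)}
    (h : IsFace (convexHull ℝ (Set.range p)) F) : F = convexHull ℝ (p '' labels p F) := by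
  rw [← Set.image_univ] at h
  conv_lhs => rw [isFace_eq_convexHull h]
  congr 2
  ext i
  simp [mem_labels]

/-- The `k`-source and `k`-target of `F` consist of faces of `F`; this labels them by vertices of
the whole polytope without needing them to be faces of it. -/
theorem isFace_isFace_eq_convexHull_labels [Fintype ι] {p : ι → Fin d → ℝ}
    {F G : Set (Fin d → ℝ)} (h : IsFace (convexHull ℝ (Set.range p)) F) (hG : IsFace F G) :
    G = convexHull ℝ (p '' labels p G) := by
  have hF := isFace_eq_convexHull_labels h
  have hGF : G ⊆ F := hG.subset
  rw [hF] at hG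
  conv_lhs => rw [isFace_eq_convexHull hG]
  congr 2
  ext i
  simp only [Finset.mem_coe, mem_labels, Set.mem_ofPred_eq]
  exact ⟨fun h => h.2, fun h => ⟨hGF h, h⟩⟩

end Faces

/-! ### Functionals as polynomials on the moment curve; admissibility -/

section MomentCurve

open Polynomial

variable {d : ℕ}

/-- The polynomial without constant term that a functional induces on the moment curve. -/
noncomputable def functionalPoly (ψ : (Fin d → ℝ) →ₗ[ℝ] ℝ) : ℝ[X] :=
  ∑ j : Fin d, C (ψ (canonicalFrame d j)) * X ^ (j.val + 1)

theorem eval_functionalPoly (ψ : (Fin d → ℝ) →ₗ[ℝ] ℝ) (s : ℝ) :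
    (functionalPoly ψ).eval s = ψ (momentCurve d s) := by
  conv_rhs => rw [← (canonicalFrame d).sum_repr (momentCurve d s)]
  rw [functionalPoly, eval_finsetSum, map_sum]
  refine Finset.sum_congr rfl fun j _ => ?_
  rw [map_smul, smul_eq_mul, eval_mul, eval_C, eval_pow, eval_X, mul_comm]
  rfl

theorem coeff_functionalPoly (ψ : (Fin d → ℝ) →ₗ[ℝ] ℝ) (j : Fin d) :
    (functionalPoly ψ).coeff (j.val + 1) = ψ (canonicalFrame d j) := by
  rw [functionalPoly, finsetSum_coeff, Finset.sum_eq_single j]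
  · simp
  · intro i _ hi
    rw [coeff_C_mul_X_pow, if_neg]
    intro h
    exact hi (Fin.ext (by omega))
  · simp

theorem degree_functionalPoly_lt {ψ : (Fin d → ℝ) →ₗ[ℝ] ℝ} {k : ℕ}
    (h : ∀ j : Fin d, k ≤ j.val → ψ (canonicalFrame d j) = 0) :
    (functionalPoly ψ).degree < (k + 1 : ℕ) := by
  rw [functionalPoly]
  refine (degree_sum_le _ _).trans_lt ?_
  rw [Finset.sup_lt_iff (WithBot.bot_lt_coe _)]
  intro j _
  by_cases hj : k ≤ j.val
  · simp [h j hj]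
  · refine (degree_C_mul_X_pow_le _ _).trans_lt ?_
    exact_mod_cast (by omega : j.val + 1 < k + 1)

theorem proj_canonicalFrame_of_le {k : ℕ} {j : Fin d} (hj : k ≤ j.val) :
    (canonicalFrame d).proj k (canonicalFrame d j) = 0 := by
  rw [Frame.proj, Basis.constr_basis, if_neg (not_lt.2 hj)]

theorem proj_canonicalFrame_of_lt {k : ℕ} {j : Fin d} (hj : j.val < k) :
    (canonicalFrame d).proj k (canonicalFrame d j) = canonicalFrame d j := by
  rw [Frame.proj, Basis.constr_basis, if_pos hj]

variable {n : ℕ} {t : Fin n → ℝ}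

/-- Vandermonde in dual form: a functional killing the projected span gives a polynomial of degree
at most `k` that is constant on at least `k + 1` nodes. It is therefore constant, so the functional
vanishes on `V_k`. -/
theorem surjOn_proj_momentCurve (ht : Function.Injective t) {k : ℕ} {J : Finset (Fin n)}
    (hJ : k + 1 ≤ J.card) :
    Set.SurjOn ((canonicalFrame d).proj k)
      (vectorSpan ℝ ((fun i => momentCurve d (t i)) '' J)) ((canonicalFrame d).flag k) := by
  set p : Fin n → Fin d → ℝ := fun i => momentCurve d (t i) with hp
  set W := (vectorSpan ℝ (p '' J)).map ((canonicalFrame d).proj k) with hW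
  suffices h : (canonicalFrame d).flag k ≤ W from fun x hx => h hx
  intro x hx
  by_contra hxW
  obtain ⟨φ, hφx, hφ⟩ := Submodule.exists_le_ker_of_notMem hxW
  set ψ := φ.comp ((canonicalFrame d).proj k) with hψ
  obtain ⟨i₀, hi₀⟩ : J.Nonempty := Finset.card_pos.1 (by omega)
  have hconst : ∀ i ∈ J, (functionalPoly ψ).eval (t i) = ψ (p i₀) := by
    intro i hi
    rw [eval_functionalPoly]
    have h1 : (canonicalFrame d).proj k (p i - p i₀) ∈ W :=
      Submodule.mem_map_of_mem (vsub_mem_vectorSpan ℝ ⟨i, hi, rfl⟩ ⟨i₀, hi₀, rfl⟩)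
    have h2 : ψ (p i - p i₀) = 0 := hφ h1
    rw [map_sub, sub_eq_zero] at h2
    exact h2
  have hdeg : (functionalPoly ψ).degree < (k + 1 : ℕ) :=
    degree_functionalPoly_lt fun j hj => by
      rw [hψ, LinearMap.comp_apply, proj_canonicalFrame_of_le hj, map_zero]
  have hzero : functionalPoly ψ = C (ψ (p i₀)) := by
    refine eq_of_degrees_lt_of_eval_index_eq J (v := t) ht.injOn ?_ ?_ fun i hi => ?_
    · exact hdeg.trans_le (by exact_mod_cast hJ)
    · refine degree_C_le.trans_lt ?_
      exact_mod_cast (by omega : 0 < J.card)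
    · rw [hconst i hi, eval_C]
  apply hφx
  have h0 : ∀ j : Fin d, ψ (canonicalFrame d j) = 0 := by
    intro j
    rw [← coeff_functionalPoly, hzero, coeff_C_succ]
  have h1 : ψ = 0 := (canonicalFrame d).ext fun j => by rw [h0 j, LinearMap.zero_apply]
  rw [← canonicalFrame_proj_eq_self hx]
  exact LinearMap.congr_fun h1 x

theorem le_finrank_of_surjOn_proj {k : ℕ} (hk : k ≤ d) {W : Submodule ℝ (Fin d → ℝ)}
    (h : Set.SurjOn ((canonicalFrame d).proj k) W ((canonicalFrame d).flag k)) :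
    k ≤ finrank ℝ W := by
  have h2 : (canonicalFrame d).flag k ≤ W.map ((canonicalFrame d).proj k) := fun y hy => h hy
  calc k = finrank ℝ ((canonicalFrame d).flag k) := (finrank_flag hk _).symm
    _ ≤ _ := Submodule.finrank_mono h2
    _ ≤ _ := Submodule.finrank_map_le _ _

theorem bijOn_proj_of_surjOn {k : ℕ} (hk : k ≤ d) {W : Submodule ℝ (Fin d → ℝ)}
    (hW : finrank ℝ W = k)
    (h : Set.SurjOn ((canonicalFrame d).proj k) W ((canonicalFrame d).flag k)) :
    Set.BijOn ((canonicalFrame d).proj k) W ((canonicalFrame d).flag k) := by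
  refine ⟨fun x _ => canonicalFrame_proj_mem_flag k x, ?_, h⟩
  let f : W →ₗ[ℝ] (canonicalFrame d).flag k :=
    ((canonicalFrame d).proj k).restrict fun x _ => canonicalFrame_proj_mem_flag k x
  have hf : Function.Injective f := by
    rw [LinearMap.injective_iff_surjective_of_finrank_eq_finrank
      (hW.trans (finrank_flag hk _).symm)]
    rintro ⟨y, hy⟩
    obtain ⟨x, hx, rfl⟩ := h hy
    exact ⟨⟨x, hx⟩, rfl⟩
  intro x hx y hy hxy
  have := @hf ⟨x, hx⟩ ⟨y, hy⟩ (Subtype.ext hxy)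
  exact congrArg Subtype.val this

theorem le_card_of_finrank_vectorSpan {k : ℕ} {J : Finset (Fin n)} (hJ : J.Nonempty)
    {p : Fin n → Fin d → ℝ} (h : k ≤ finrank ℝ (vectorSpan ℝ (p '' J))) : k + 1 ≤ J.card := by
  classical
  have h1 := finrank_vectorSpan_image_finset_le ℝ p J (n := J.card - 1)
    (Nat.succ_pred_eq_of_pos hJ.card_pos).symm
  rw [Finset.coe_image] at h1
  have := hJ.card_pos
  omega

/-- The number of points of the moment curve spanning a polytope of dimension less than `d`. -/
theorem card_eq_of_finrank_vectorSpan (ht : Function.Injective t) {k : ℕ} (hk : k < d)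
    {J : Finset (Fin n)} (hJ : J.Nonempty)
    (h : finrank ℝ (vectorSpan ℝ ((fun i => momentCurve d (t i)) '' J)) = k) :
    J.card = k + 1 := by
  refine le_antisymm ?_ (le_card_of_finrank_vectorSpan hJ h.ge)
  by_contra hlt
  -- With `k + 2` points the span would surject onto `V_{k+1}`, which has dimension `k + 1` because
  -- `k < d`.
  have := le_finrank_of_surjOn_proj (d := d) (k := k + 1) hk
    (surjOn_proj_momentCurve ht (J := J) (by omega))
  omega

theorem isPolytope_convexHull_range (p : Fin n → Fin d → ℝ) :
    IsPolytope (convexHull ℝ (Set.range p)) :=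
  ⟨(Set.finite_range p).toFinset, by simp⟩

theorem labels_nonempty {p : Fin n → Fin d → ℝ} {F : Set (Fin d → ℝ)} (hF : F.Nonempty)
    (h : F = convexHull ℝ (p '' labels p F)) : (labels p F).Nonempty := by
  rw [h] at hF
  have := convexHull_nonempty_iff.1 hF
  exact_mod_cast this.of_image

theorem finrank_lin_le (F : Set (Fin d → ℝ)) : finrank ℝ (lin F) ≤ d :=
  (Submodule.finrank_le _).trans_eq (finrank_fin_fun ℝ)

theorem cyclicPolytope_frames (ht : Function.Injective t) :
    (canonicalFrame d).Frames (cyclicPolytope d t) := by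
  refine ⟨isPolytope_convexHull_range _, fun F hF k hk => ?_⟩
  have hFJ := isFace_eq_convexHull_labels hF
  have hne := nonempty_of_dim_eq hk
  have hrank := finrank_of_dim_eq hk
  have hkd : k ≤ d := hrank ▸ finrank_lin_le F
  have hlin := vectorSpan_convexHull ((fun i => momentCurve d (t i)) ''
    labels (fun i => momentCurve d (t i)) F)
  rw [← hFJ] at hlin
  refine bijOn_proj_of_surjOn hkd hrank ?_
  unfold lin
  rw [hlin]
  refine surjOn_proj_momentCurve ht (le_card_of_finrank_vectorSpan
    (p := fun i => momentCurve d (t i)) (labels_nonempty hne hFJ) ?_)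
  rw [← hlin, hrank]

end MomentCurve

/-! ### The lexicographic invariant of label sets -/

section SignVector

variable {n : ℕ}

/-- The parities of the numbers of elements of `J` beyond `i`, as signs. -/
def signVector (J : Finset (Fin n)) (i : Fin n) : ℤ := (-1) ^ (J.filter (i < ·)).card

theorem signVector_mul_prod_pos {t : Fin n → ℝ} (ht : StrictMono t) {J : Finset (Fin n)}
    {i : Fin n} (hi : i ∉ J) : 0 < (signVector J i : ℝ) * ∏ j ∈ J, (t i - t j) := by
  have h : (signVector J i : ℝ) * ∏ j ∈ J, (t i - t j) =
      ∏ j ∈ J, (if i < j then (-1 : ℝ) else 1) * (t i - t j) := by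
    rw [Finset.prod_mul_distrib, ← Finset.prod_filter, Finset.prod_const, signVector]
    push_cast
    rfl
  rw [h]
  refine Finset.prod_pos fun j hj => ?_
  split_ifs with hij
  · linarith [ht hij]
  · have : j < i := lt_of_le_of_ne (not_lt.1 hij) fun h => hi (h ▸ hj)
    linarith [ht this]

theorem signVector_eq_one_or (J : Finset (Fin n)) (i : Fin n) :
    signVector J i = 1 ∨ signVector J i = -1 := neg_one_pow_eq_or ℤ _

theorem card_filter_le_add_card_filter_lt (J : Finset (Fin n)) (i : Fin n) :
    (J.filter (· ≤ i)).card + (J.filter (i < ·)).card = J.card := by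
  simpa only [not_le] using J.card_filter_add_card_filter_not (· ≤ i)

/-- Up to and including `m`, `J'` has one element more than `J`; the cardinalities agree, so beyond
`m` it has one fewer and the parity flips. -/
theorem signVector_eq_neg {J J' : Finset (Fin n)} (hcard : J.card = J'.card) {m : Fin n}
    (hmin : ∀ i < m, i ∈ J ↔ i ∈ J') (hm : m ∈ J') (hm' : m ∉ J) :
    signVector J' m = - signVector J m := by
  have h1 : J'.filter (· ≤ m) = insert m (J.filter (· ≤ m)) := by
    ext i
    rcases lt_trichotomy i m with h | h | h
    · simp [h.le, h.ne, hmin i h]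
    · simp [h, hm]
    · simp [h.not_ge, h.ne']
  have h2 : (J'.filter (· ≤ m)).card = (J.filter (· ≤ m)).card + 1 := by
    rw [h1, Finset.card_insert_of_notMem (by simp [hm'])]
  have h3 := card_filter_le_add_card_filter_lt J m
  have h4 := card_filter_le_add_card_filter_lt J' m
  have h5 : (J.filter (m < ·)).card = (J'.filter (m < ·)).card + 1 := by omega
  rw [signVector, signVector, h5, pow_succ]
  ring

/-- Passing from a lower to an upper facet of a cyclic polytope decreases the sign vector
lexicographically. -/
theorem signVector_lt {t : Fin n → ℝ} (ht : StrictMono t) {I J J' : Finset (Fin n)}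
    (hcard : J.card = J'.card) (hJ : J ⊆ I) (hJ' : J' ⊆ I)
    (hlow : ∀ i ∈ I, 0 ≤ ∏ j ∈ J, (t i - t j)) (hup : ∀ i ∈ I, ∏ j ∈ J', (t i - t j) ≤ 0)
    (hI : ¬ I ⊆ J) : toLex (signVector J') < toLex (signVector J) := by
  have hne : (symmDiff J J').Nonempty := by
    rw [Finset.symmDiff_nonempty]
    rintro rfl
    obtain ⟨i, hi, hiJ⟩ := Finset.not_subset.1 hI
    obtain ⟨j, hj, h⟩ := Finset.prod_eq_zero_iff.1 (le_antisymm (hup i hi) (hlow i hi))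
    exact hiJ (ht.injective (sub_eq_zero.1 h) ▸ hj)
  -- At `m` exactly one of the two products is nonzero. Its sign is prescribed by `hlow` or `hup`,
  -- which fixes one sign vector there, and the other is its negative.
  set m := (symmDiff J J').min' hne
  have hmin : ∀ i < m, i ∈ J ↔ i ∈ J' := by
    intro i hi
    have : i ∉ symmDiff J J' := fun h => (Finset.min'_le _ _ h).not_gt hi
    rw [Finset.mem_symmDiff] at this
    tauto
  have heq : ∀ i < m, signVector J' i = signVector J i := by
    intro i hi
    have h1 : J'.filter (· ≤ i) = J.filter (· ≤ i) := by
      ext j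
      simp only [Finset.mem_filter, and_congr_left_iff]
      exact fun hj => (hmin j (hj.trans_lt hi)).symm
    have h3 := card_filter_le_add_card_filter_lt J i
    have h4 := card_filter_le_add_card_filter_lt J' i
    rw [h1] at h4
    rw [signVector, signVector, show (J'.filter (i < ·)).card = (J.filter (i < ·)).card by omega]
  have hlt : signVector J' m < signVector J m := by
    rcases Finset.mem_symmDiff.1 ((symmDiff J J').min'_mem hne) with ⟨h1, h2⟩ | ⟨h1, h2⟩
    · have h3 := signVector_eq_neg hcard.symm (fun i hi => (hmin i hi).symm) h1 h2
      have h4 := signVector_mul_prod_pos ht h2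
      rcases signVector_eq_one_or J' m with h | h
      · rw [h] at h4
        have := hup m (hJ h1)
        norm_num at h4
        linarith
      · rw [h3, h]
        norm_num
    · have h3 := signVector_eq_neg hcard hmin h1 h2
      have h4 := signVector_mul_prod_pos ht h2
      rcases signVector_eq_one_or J m with h | h
      · rw [h3, h]
        norm_num
      · rw [h] at h4
        have := hlow m (hJ' h1)
        norm_num at h4
        linarith
  exact ⟨m, heq, hlt⟩

end SignVector

/-! ### Loop-freeness of the cyclic polytope -/

section LoopFree

open Polynomial

variable {d n : ℕ} {t : Fin n → ℝ}

/-- The induced polynomial minus its maximum has degree at most `k + 1`, leading coefficient `ψ` of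
the frame vector, and the `k + 1` nodes of `J` as roots, so it equals the displayed product. -/
theorem apply_mul_prod_le_of_mem_normalCone (ht : Function.Injective t) {k : ℕ} (hk : k < d)
    {J : Finset (Fin n)} (hJ : J.card = k + 1) {F G : Set (Fin d → ℝ)}
    (hG : ∀ j ∈ J, momentCurve d (t j) ∈ G) {ψ : StrongDual ℝ (Fin d → ℝ)}
    (hψ : ψ ∈ normalCone ((canonicalFrame d).proj (k + 1) '' F)
      ((canonicalFrame d).proj (k + 1) '' G)) {s : ℝ} (hs : momentCurve d s ∈ F) :
    ψ (canonicalFrame d ⟨k, hk⟩) * ∏ j ∈ J, (s - t j) ≤ 0 := by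
  set φ := (ψ : (Fin d → ℝ) →ₗ[ℝ] ℝ).comp ((canonicalFrame d).proj (k + 1)) with hφ
  obtain ⟨j₀, hj₀⟩ : J.Nonempty := Finset.card_pos.1 (by omega)
  set M := φ (momentCurve d (t j₀)) with hM
  have hGmax : ∀ x ∈ G, ∀ y ∈ F, φ y ≤ φ x := by
    intro x hx y hy
    have h1 : (canonicalFrame d).proj (k + 1) x ∈ (canonicalFrame d).proj (k + 1) '' G :=
      ⟨x, hx, rfl⟩
    change _ = _ at hψ
    rw [hψ] at h1
    exact h1.2 _ ⟨y, hy, rfl⟩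
  have hGF : ∀ x ∈ G, ∀ y ∈ G, φ x = φ y := by
    intro x hx y hy
    have h1 : ∀ z ∈ G, ∃ w ∈ F, φ w = φ z := by
      intro z hz
      have h2 : (canonicalFrame d).proj (k + 1) z ∈ (canonicalFrame d).proj (k + 1) '' G :=
        ⟨z, hz, rfl⟩
      change _ = _ at hψ
      rw [hψ] at h2
      obtain ⟨⟨w, hw, hwz⟩, _⟩ := h2
      exact ⟨w, hw, congrArg ψ hwz⟩
    obtain ⟨w, hw, hwx⟩ := h1 x hx
    obtain ⟨w', hw', hwy⟩ := h1 y hy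
    exact le_antisymm (hwx ▸ hGmax y hy w hw) (hwy ▸ hGmax x hx w' hw')
  set a := ψ (canonicalFrame d ⟨k, hk⟩) with ha
  have hcoeff : (functionalPoly φ).coeff (k + 1) = a := by
    have := coeff_functionalPoly φ ⟨k, hk⟩
    rwa [hφ, LinearMap.comp_apply, proj_canonicalFrame_of_lt (Nat.lt_succ_self k)] at this
  have hdeg : (functionalPoly φ).degree < (k + 1 + 1 : ℕ) :=
    degree_functionalPoly_lt fun j hj => by
      rw [hφ, LinearMap.comp_apply, proj_canonicalFrame_of_le hj, map_zero]
  have hprod : (∏ j ∈ J, (X - C (t j))).natDegree = k + 1 := by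
    rw [natDegree_prod_of_monic _ _ fun j _ => monic_X_sub_C _]
    simp [hJ]
  have hmonic : (∏ j ∈ J, (X - C (t j))).Monic := monic_prod_of_monic _ _ fun j _ => monic_X_sub_C _
  have hpoly : functionalPoly φ - C M - C a * ∏ j ∈ J, (X - C (t j)) = 0 := by
    refine eq_zero_of_degree_lt_of_eval_index_eq_zero (v := t) (s := J) ht.injOn ?_ ?_
    · rw [hJ]
      refine (degree_lt_iff_coeff_zero _ _).2 fun i hi => ?_
      rw [coeff_sub, coeff_sub, coeff_C_mul, coeff_C_of_ne_zero (by omega)]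
      rcases hi.eq_or_lt with rfl | hi
      · have h1 : (∏ j ∈ J, (X - C (t j))).coeff (k + 1) = 1 := by
          rw [← hprod]
          exact hmonic.coeff_natDegree
        rw [hcoeff, h1]
        ring
      · rw [coeff_eq_zero_of_degree_lt (hdeg.trans_le (by exact_mod_cast hi)),
          coeff_eq_zero_of_natDegree_lt (p := ∏ j ∈ J, (X - C (t j))) (by omega)]
        ring
    · intro i hi
      rw [eval_sub, eval_sub, eval_functionalPoly, eval_C, eval_mul, eval_prod,
        Finset.prod_eq_zero hi (by simp), hM, hGF _ (hG i hi) _ (hG j₀ hj₀)]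
      ring
  have h1 := congrArg (eval s) hpoly
  simp only [eval_sub, eval_functionalPoly, eval_C, eval_mul, eval_prod, eval_X, eval_zero] at h1
  have h2 := hGmax _ (hG j₀ hj₀) _ hs
  linarith

theorem cyclicPolytope_loopFree (ht : StrictMono t) :
    (canonicalFrame d).LoopFree (cyclicPolytope d t) := by
  rintro k m F ⟨⟨hF, hstr⟩, i, j, hij, hFij⟩
  wlog hlt : i < j generalizing i j
  · exact this j i hij.symm hFij.symm (lt_of_le_of_ne (not_lt.1 hlt) hij.symm)
  set p : Fin n → Fin d → ℝ := fun i => momentCurve d (t i) with hp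
  have hkd : k < d := by
    obtain ⟨_, h⟩ := hF i
    rw [dim] at h
    split_ifs at h
    · have := finrank_lin_le (F i)
      omega
    · omega
  have hlin : ∀ {G : Set (Fin d → ℝ)}, G = convexHull ℝ (p '' labels p G) →
      lin G = vectorSpan ℝ (p '' labels p G) := by
    intro G hG
    conv_lhs => rw [hG]
    exact vectorSpan_convexHull _
  have hface : ∀ l G, IsFace (F l) G → dim G = k → (labels p G).card = k + 1 ∧
      Set.SurjOn ((canonicalFrame d).proj k) (lin G) ((canonicalFrame d).flag k) ∧
      labels p G ⊆ labels p (F l) ∧ ¬ labels p (F l) ⊆ labels p G := by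
    intro l G hG hdim
    have hGJ := isFace_isFace_eq_convexHull_labels (hF l).1 hG
    have hJ := labels_nonempty (nonempty_of_dim_eq hdim) hGJ
    have hcard : (labels p G).card = k + 1 := by
      refine card_eq_of_finrank_vectorSpan (d := d) ht.injective hkd hJ ?_
      rw [← hlin hGJ, finrank_of_dim_eq hdim]
    have hsub : labels p G ⊆ labels p (F l) := fun i hi =>
      mem_labels.2 (hG.subset (mem_labels.1 hi))
    refine ⟨hcard, ?_, hsub, fun h => ?_⟩
    · rw [hlin hGJ]
      exact surjOn_proj_momentCurve ht.injective hcard.ge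
    · have h1 : G = F l := by
        rw [hGJ, isFace_eq_convexHull_labels (hF l).1, subset_antisymm hsub h]
      have := (hF l).2
      rw [← h1, hdim] at this
      exact lt_irrefl _ this
  have hsrc : ∀ l, ∀ G ∈ (canonicalFrame d).kSource k (F l), ∀ i ∈ labels p (F l),
      0 ≤ ∏ j ∈ labels p G, (t i - t j) := by
    intro l G hG i hi
    obtain ⟨hcard, hsurj, _, _⟩ := hface l G hG.1.1 hG.1.2.1
    obtain ⟨ψ, hψ, hneg⟩ := exists_normal_of_mem_kSource hkd hsurj hG
    have := apply_mul_prod_le_of_mem_normalCone ht.injective hkd hcard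
      (fun j hj => (mem_labels (p := p)).1 hj) hψ ((mem_labels (p := p)).1 hi)
    exact nonneg_of_mul_nonpos_right this hneg
  have htgt : ∀ l, ∀ G ∈ (canonicalFrame d).kTarget k (F l), ∀ i ∈ labels p (F l),
      ∏ j ∈ labels p G, (t i - t j) ≤ 0 := by
    intro l G hG i hi
    obtain ⟨hcard, hsurj, _, _⟩ := hface l G hG.1.1 hG.1.2.1
    obtain ⟨ψ, hψ, hpos⟩ := exists_normal_of_mem_kTarget hkd hsurj hG
    have := apply_mul_prod_le_of_mem_normalCone ht.injective hkd hcard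
      (fun j hj => (mem_labels (p := p)).1 hj) hψ ((mem_labels (p := p)).1 hi)
    exact nonpos_of_mul_nonpos_right this hpos
  have hstep : ∀ l, ∀ G ∈ (canonicalFrame d).kSource k (F l),
      ∀ G' ∈ (canonicalFrame d).kTarget k (F l),
      toLex (signVector (labels p G')) < toLex (signVector (labels p G)) := by
    intro l G hG G' hG'
    obtain ⟨hcard, _, hsub, hnsub⟩ := hface l G hG.1.1 hG.1.2.1
    obtain ⟨hcard', _, hsub', _⟩ := hface l G' hG'.1.1 hG'.1.2.1
    exact signVector_lt ht (hcard.trans hcard'.symm) hsub hsub' (hsrc l G hG) (htgt l G' hG') hnsub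
  obtain ⟨G₀, hG₀, hG₀'⟩ := hstr i ⟨i + 1, by omega⟩ rfl
  -- `G₀` links `F i` to its successor. The links that follow have smaller sign vectors, yet the one
  -- entering `F j = F i` is a source face of `F i` and must exceed its target face `G₀`.
  have hchain : ∀ r, ∀ h : i.val + 1 + r < m, ∃ G ∈ (canonicalFrame d).kSource k (F ⟨i + 1 + r, h⟩),
      toLex (signVector (labels p G)) ≤ toLex (signVector (labels p G₀)) := by
    intro r
    induction r with
    | zero => exact fun h => ⟨G₀, hG₀', le_rfl⟩
    | succ r ih =>
      intro h
      obtain ⟨G, hG, hle⟩ := ih (by omega)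
      obtain ⟨G', hG', hG''⟩ := hstr ⟨i + 1 + r, by omega⟩ ⟨i + 1 + (r + 1), h⟩ rfl
      exact ⟨G', hG'', (hstep _ G hG G' hG').le.trans hle⟩
  obtain ⟨G, hG, hle⟩ := hchain (j.val - (i.val + 1)) (by omega)
  have hj : (⟨i.val + 1 + (j.val - (i.val + 1)), by omega⟩ : Fin m) = j := Fin.ext (by simp; omega)
  rw [hj, ← hFij] at hG
  exact (hstep i G hG G₀ hG₀).not_ge hle

end LoopFree

/-! ### Linear images and generic admissibility -/

section Transport

variable {d : ℕ}

theorem isFace_image (L : (Fin d → ℝ) ≃ₗ[ℝ] (Fin d → ℝ)) {P F : Set (Fin d → ℝ)}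
    (h : IsFace P F) : IsFace (L '' P) (L '' F) := by
  intro hne
  obtain ⟨ψ, hψ⟩ := h hne.of_image
  refine ⟨ψ.comp (LinearMap.toContinuousLinearMap (L.symm : (Fin d → ℝ) →ₗ[ℝ] (Fin d → ℝ))), ?_⟩
  ext x
  obtain ⟨x, rfl⟩ := L.surjective x
  rw [L.injective.mem_set_image, hψ]
  simp

theorem symm_image_image (L : (Fin d → ℝ) ≃ₗ[ℝ] (Fin d → ℝ)) (F : Set (Fin d → ℝ)) :
    L.symm '' (L '' F) = F := by
  rw [← Set.image_comp]
  simp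

theorem combinatoriallyEquivalent_image (L : (Fin d → ℝ) ≃ₗ[ℝ] (Fin d → ℝ))
    (P : Set (Fin d → ℝ)) : CombinatoriallyEquivalent (L '' P) P := by
  refine ⟨⟨⟨fun F => ⟨L.symm '' F.1, ?_⟩, fun F => ⟨L '' F.1, isFace_image L F.2⟩, ?_, ?_⟩, ?_⟩⟩
  · have := isFace_image L.symm F.2
    rwa [symm_image_image] at this
  · intro F
    exact Subtype.ext (symm_image_image L.symm F.1)
  · intro F
    exact Subtype.ext (symm_image_image L F.1)
  · intro F G
    exact Set.image_subset_image_iff L.symm.injective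

theorem dim_image (L : (Fin d → ℝ) ≃ₗ[ℝ] (Fin d → ℝ)) (F : Set (Fin d → ℝ)) :
    dim (L '' F) = dim F := by
  rcases F.eq_empty_or_nonempty with rfl | hF
  · simp
  · rw [dim_of_nonempty hF, dim_of_nonempty (hF.image _)]
    have h : lin (L '' F) = (lin F).map (L : (Fin d → ℝ) →ₗ[ℝ] (Fin d → ℝ)) :=
      lin_image (L : (Fin d → ℝ) →ₗ[ℝ] (Fin d → ℝ)) F
    rw [h, LinearEquiv.finrank_map_eq]

theorem bijOn_proj_of_ker {k : ℕ} (hk : k ≤ d) {W : Submodule ℝ (Fin d → ℝ)}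
    (hW : finrank ℝ W = k) (h : ∀ x ∈ W, (canonicalFrame d).proj k x = 0 → x = 0) :
    Set.BijOn ((canonicalFrame d).proj k) W ((canonicalFrame d).flag k) := by
  refine bijOn_proj_of_surjOn hk hW ?_
  let f : W →ₗ[ℝ] (canonicalFrame d).flag k :=
    ((canonicalFrame d).proj k).restrict fun x _ => canonicalFrame_proj_mem_flag k x
  have hf : Function.Injective f := by
    rw [← LinearMap.ker_eq_bot, LinearMap.ker_eq_bot']
    rintro ⟨x, hx⟩ h0
    exact Subtype.ext (h x hx (congrArg Subtype.val h0))
  rw [LinearMap.injective_iff_surjective_of_finrank_eq_finrank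
      (hW.trans (finrank_flag hk _).symm)] at hf
  intro y hy
  obtain ⟨x, hx⟩ := hf ⟨y, hy⟩
  exact ⟨x.1, x.2, congrArg Subtype.val hx⟩

theorem admissible_image {P : Set (Fin d → ℝ)} (L : (Fin d → ℝ) ≃ₗ[ℝ] (Fin d → ℝ))
    (h : ∀ F, IsFace P F → ∀ k : ℕ, dim F = k →
      ∀ x ∈ lin F, (canonicalFrame d).proj k (L x) = 0 → x = 0) :
    (canonicalFrame d).Admissible (L '' P) := by
  intro G hG k hk
  have hG' := isFace_image L.symm hG
  rw [symm_image_image] at hG'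
  have hk' : dim (L.symm '' G) = k := by rw [dim_image, hk]
  refine bijOn_proj_of_ker (finrank_of_dim_eq hk ▸ finrank_lin_le G) (finrank_of_dim_eq hk) ?_
  intro x hx hx0
  have h1 : lin (L.symm '' G) = (lin G).map (L.symm : (Fin d → ℝ) →ₗ[ℝ] (Fin d → ℝ)) :=
    lin_image (L.symm : (Fin d → ℝ) →ₗ[ℝ] (Fin d → ℝ)) G
  have h2 := h _ hG' k hk' (L.symm x) (h1 ▸ Submodule.mem_map_of_mem hx) (by simpa using hx0)
  simpa using h2

/-- Adding a multiple of the identity to a linear map destroys the isomorphism `π_k : W → V_k`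
only for finitely many multiples. -/
theorem finite_setOf_proj_smul_add_eq_zero {k : ℕ} {W : Submodule ℝ (Fin d → ℝ)}
    (h : Set.BijOn ((canonicalFrame d).proj k) W ((canonicalFrame d).flag k))
    (M : (Fin d → ℝ) →ₗ[ℝ] (Fin d → ℝ)) :
    {s : ℝ | ∃ x ∈ W, x ≠ 0 ∧ (canonicalFrame d).proj k (s • x + M x) = 0}.Finite := by
  let f : W →ₗ[ℝ] (canonicalFrame d).flag k :=
    ((canonicalFrame d).proj k).restrict fun x _ => canonicalFrame_proj_mem_flag k x
  have hf : Function.Bijective f := by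
    refine ⟨fun x y hxy => Subtype.ext (h.injOn x.2 y.2 (congrArg Subtype.val hxy)), ?_⟩
    rintro ⟨y, hy⟩
    obtain ⟨x, hx, rfl⟩ := h.surjOn hy
    exact ⟨⟨x, hx⟩, rfl⟩
  let g : W →ₗ[ℝ] (canonicalFrame d).flag k :=
    ((canonicalFrame d).proj k ∘ₗ M).restrict fun x _ => canonicalFrame_proj_mem_flag k (M x)
  -- After identifying `W` with `V_k` by `π_k`, a bad `s` is the negative of an eigenvalue of `N`,
  -- and there are finitely many eigenvalues.
  let N : Module.End ℝ ((canonicalFrame d).flag k) := g ∘ₗ (LinearEquiv.ofBijective f hf).symm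
  refine ((Module.End.finite_hasEigenvalue N).preimage neg_injective.injOn).subset ?_
  rintro s ⟨x, hx, hx0, hs⟩
  refine Module.End.hasEigenvalue_of_hasEigenvector (x := f ⟨x, hx⟩) ⟨?_, ?_⟩
  · rw [Module.End.mem_eigenspace_iff]
    have h1 : N (f ⟨x, hx⟩) = g ⟨x, hx⟩ := by
      change g ((LinearEquiv.ofBijective f hf).symm ((LinearEquiv.ofBijective f hf) ⟨x, hx⟩)) = _
      rw [LinearEquiv.symm_apply_apply]
    rw [h1]
    refine Subtype.ext ?_
    change (canonicalFrame d).proj k (M x) = -s • (canonicalFrame d).proj k x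
    rw [map_add, map_smul] at hs
    rw [neg_smul]
    exact eq_neg_of_add_eq_zero_right hs
  · intro h0
    have h1 : (⟨x, hx⟩ : W) = 0 := hf.1 (h0.trans (map_zero f).symm)
    exact hx0 (congrArg Subtype.val h1)

theorem exists_generic_perturbation {n : ℕ} {t : Fin n → ℝ} (ht : Function.Injective t)
    (M : (Fin d → ℝ) →ₗ[ℝ] (Fin d → ℝ)) {U : Set ℝ} (hU : U.Infinite) :
    ∃ s ∈ U, ∃ L : (Fin d → ℝ) ≃ₗ[ℝ] (Fin d → ℝ), (∀ x, L x = s • x + M x) ∧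
      (canonicalFrame d).Admissible (L '' cyclicPolytope d t) := by
  let p : Fin n → Fin d → ℝ := fun i => momentCurve d (t i)
  let W : Finset (Fin n) → Submodule ℝ (Fin d → ℝ) := fun J => vectorSpan ℝ (p '' J)
  let bad : Submodule ℝ (Fin d → ℝ) → ℕ → Set ℝ := fun W k =>
    {s : ℝ | ∃ x ∈ W, x ≠ 0 ∧ (canonicalFrame d).proj k (s • x + M x) = 0}
  -- The term `bad ⊤ d` guards invertibility of `s • id + M`; the others guard the spans of label
  -- sets that already project isomorphically, among them those of all nonempty faces of the cyclic
  -- polytope.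
  let B : Set ℝ := bad ⊤ d ∪ ⋃ (J : Finset (Fin n)) (_ : Set.BijOn
    ((canonicalFrame d).proj (finrank ℝ (W J))) (W J)
    ((canonicalFrame d).flag (finrank ℝ (W J)))), bad (W J) (finrank ℝ (W J))
  have htop : Set.BijOn ((canonicalFrame d).proj d) (⊤ : Submodule ℝ (Fin d → ℝ))
      ((canonicalFrame d).flag d) := by
    refine bijOn_proj_of_ker le_rfl (by simp) fun x _ hx => ?_
    rwa [canonicalFrame_proj_eq_self] at hx
    exact mem_canonicalFrame_flag.2 fun i hi => absurd i.2 (not_lt.2 hi)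
  have hB : B.Finite := by
    refine (finite_setOf_proj_smul_add_eq_zero htop M).union (Set.finite_iUnion fun J => ?_)
    exact Set.finite_iUnion fun hJ => finite_setOf_proj_smul_add_eq_zero hJ M
  obtain ⟨s, hsU, hsB⟩ := (hU.sdiff hB).nonempty
  have hs : ∀ x : Fin d → ℝ, (canonicalFrame d).proj d (s • x + M x) = 0 → x = 0 := by
    intro x hx
    by_contra hx0
    exact hsB (Or.inl ⟨x, Submodule.mem_top, hx0, hx⟩)
  let T : (Fin d → ℝ) →ₗ[ℝ] (Fin d → ℝ) := s • LinearMap.id + M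
  have hT : Function.Injective T := by
    rw [← LinearMap.ker_eq_bot, LinearMap.ker_eq_bot']
    intro x hx
    have hx' : s • x + M x = 0 := hx
    exact hs x (by rw [hx', map_zero])
  refine ⟨s, hsU, LinearEquiv.ofInjectiveEndo T hT, fun x => rfl, ?_⟩
  refine admissible_image _ fun F hF k hk x hx hx0 => ?_
  by_contra hne
  have hFJ := isFace_eq_convexHull_labels hF
  have hlin : lin F = W (labels p F) := by
    conv_lhs => rw [hFJ]
    exact vectorSpan_convexHull _
  have hrank := finrank_of_dim_eq hk
  refine hsB (Or.inr (Set.mem_iUnion.2 ⟨labels p F, Set.mem_iUnion.2 ⟨?_, x, hlin ▸ hx, hne, ?_⟩⟩))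
  · rw [← hlin, hrank]
    exact (cyclicPolytope_frames ht).2 F hF k hk
  · rw [← hlin, hrank]
    exact hx0

end Transport

/-! ### Triangular faces of cyclic polytopes -/

section PolynomialFunctionals

open Polynomial

variable {d : ℕ}

/-- The functional that evaluates `q - q(0)` along the moment curve. -/
noncomputable def polynomialFunctional (d : ℕ) (q : ℝ[X]) : (Fin d → ℝ) →ₗ[ℝ] ℝ :=
  ∑ j : Fin d, q.coeff (j.val + 1) • LinearMap.proj j

theorem polynomialFunctional_momentCurve {q : ℝ[X]} (hq : q.natDegree ≤ d) (s : ℝ) :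
    polynomialFunctional d q (momentCurve d s) = q.eval s - q.coeff 0 := by
  rw [eval_eq_sum_range' (Nat.lt_succ_of_le hq), Finset.sum_range_succ', ← Fin.sum_univ_eq_sum_range
    (fun i => q.coeff (i + 1) * s ^ (i + 1))]
  simp [polynomialFunctional, momentCurve]

theorem isFace_cyclicPolytope_of_polynomial {n : ℕ} {t : Fin n → ℝ} {q : ℝ[X]}
    (hq : q.natDegree ≤ d) (hle : ∀ i, q.eval (t i) ≤ 0) (hne : ∃ i, q.eval (t i) = 0) :
    IsFace (cyclicPolytope d t)
      (convexHull ℝ ((fun i => momentCurve d (t i)) '' {i | q.eval (t i) = 0})) := by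
  intro _
  refine ⟨LinearMap.toContinuousLinearMap (polynomialFunctional d q), ?_⟩
  ext x
  have h := mem_convexHull_argmax_iff (fun i => momentCurve d (t i)) Set.univ
    (polynomialFunctional d q) (c := - q.coeff 0) (fun i _ => by
      rw [polynomialFunctional_momentCurve hq]
      linarith [hle i]) (by
      obtain ⟨i, hi⟩ := hne
      exact ⟨i, Set.mem_univ i, by rw [polynomialFunctional_momentCurve hq, hi, zero_sub]⟩) x
  simp only [polynomialFunctional_momentCurve hq, Set.mem_univ, true_and, Set.image_univ,
    sub_eq_neg_self] at h
  exact h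

/-- The exposing polynomial is `-(X - t_a)(X - t_b)(X - t_c)^2`: no node lies strictly between `t_a`
and `t_b`, so it is nonpositive at all nodes. Its degree is why `d ≥ 4` is required. -/
theorem isFace_cyclicPolytope_triangle_of_succ {n : ℕ} {t : Fin n → ℝ} (ht : StrictMono t)
    (hd : 4 ≤ d) {a b c : Fin n} (hab : a.val + 1 = b.val) :
    IsFace (cyclicPolytope d t) (convexHull ℝ ((fun i => momentCurve d (t i)) '' {a, b, c})) := by
  set q : ℝ[X] := C (-1) * ((X - C (t a)) * (X - C (t b)) * (X - C (t c)) ^ 2) with hq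
  have heval : ∀ i, q.eval (t i) = -((t i - t a) * (t i - t b) * (t i - t c) ^ 2) := by
    intro i
    simp [hq]
  have hset : ({a, b, c} : Set (Fin n)) = {i | q.eval (t i) = 0} := by
    ext i
    change i ∈ ({a, b, c} : Set (Fin n)) ↔ q.eval (t i) = 0
    rw [heval]
    simp [sub_eq_zero, ht.injective.eq_iff, or_assoc]
  rw [hset]
  refine isFace_cyclicPolytope_of_polynomial ?_ (fun i => ?_) ⟨a, by rw [heval]; ring⟩
  · refine le_trans ?_ hd
    rw [hq]
    compute_degree
  · rw [heval, neg_nonpos]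
    refine mul_nonneg ?_ (sq_nonneg _)
    rcases le_or_gt i a with h | h
    · have h1 := ht.monotone h
      have h2 := ht.monotone (show i ≤ b from Fin.le_def.2 (by have := Fin.le_def.1 h; omega))
      exact mul_nonneg_of_nonpos_of_nonpos (by linarith) (by linarith)
    · have h1 := ht h
      have h2 := ht.monotone (show b ≤ i from Fin.le_def.2 (by have := Fin.lt_def.1 h; omega))
      exact mul_nonneg (by linarith) (by linarith)

/-- Some two of the three labels are consecutive. -/
def HasConsecutive {n : ℕ} (a b c : Fin n) : Prop :=
  a.val + 1 = b.val ∨ b.val + 1 = a.val ∨ a.val + 1 = c.val ∨ c.val + 1 = a.val ∨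
    b.val + 1 = c.val ∨ c.val + 1 = b.val

instance {n : ℕ} (a b c : Fin n) : Decidable (HasConsecutive a b c) := by
  unfold HasConsecutive
  infer_instance

theorem isFace_cyclicPolytope_triangle {n : ℕ} {t : Fin n → ℝ} (ht : StrictMono t)
    (hd : 4 ≤ d) {a b c : Fin n} (h : HasConsecutive a b c) :
    IsFace (cyclicPolytope d t) (convexHull ℝ ((fun i => momentCurve d (t i)) '' {a, b, c})) := by
  rcases h with h | h | h | h | h | h
  · exact isFace_cyclicPolytope_triangle_of_succ ht hd h
  · rw [Set.insert_comm]
    exact isFace_cyclicPolytope_triangle_of_succ ht hd h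
  · rw [Set.pair_comm]
    exact isFace_cyclicPolytope_triangle_of_succ ht hd h
  · rw [Set.pair_comm, Set.insert_comm]
    exact isFace_cyclicPolytope_triangle_of_succ ht hd h
  · rw [Set.insert_comm, Set.pair_comm]
    exact isFace_cyclicPolytope_triangle_of_succ ht hd h
  · rw [Set.pair_comm, Set.insert_comm, Set.pair_comm]
    exact isFace_cyclicPolytope_triangle_of_succ ht hd h

end PolynomialFunctionals

/-! ### Cellular `1`-loops from planar zigzags -/

section PlaneLoops

variable {d : ℕ}

/-- The determinant of two vectors projected to the plane `V_2`. -/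
def planeDet (hd : 2 ≤ d) (u v : Fin d → ℝ) : ℝ :=
  u ⟨0, by omega⟩ * v ⟨1, by omega⟩ - u ⟨1, by omega⟩ * v ⟨0, by omega⟩

theorem edge_mem_kSource_or_kTarget (hd : 2 ≤ d) {a b z : Fin d → ℝ} {c : ℝ}
    (hdet : c * planeDet hd (b - a) (z - a) < 0) :
    (c * (b - a) ⟨0, by omega⟩ < 0 →
      convexHull ℝ {a, b} ∈ (canonicalFrame d).kSource 1 (convexHull ℝ {a, b, z})) ∧
    (0 < c * (b - a) ⟨0, by omega⟩ →
      convexHull ℝ {a, b} ∈ (canonicalFrame d).kTarget 1 (convexHull ℝ {a, b, z})) := by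
  set i₀ : Fin d := ⟨0, by omega⟩ with hi₀
  set i₁ : Fin d := ⟨1, by omega⟩
  -- The normal to the edge in the plane, `c` times the determinant against `b - a`. The scalar `c`
  -- makes it smaller at `z`, and its value on the second frame vector is `c * (b - a) i₀`.
  let φ : (Fin d → ℝ) →ₗ[ℝ] ℝ := (c * (b - a) i₀) • LinearMap.proj i₁ -
    (c * (b - a) i₁) • LinearMap.proj i₀
  have hφ : ∀ x, φ x = c * planeDet hd (b - a) x := fun x => by
    simp only [φ, LinearMap.sub_apply, LinearMap.smul_apply, LinearMap.proj_apply, smul_eq_mul,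
      planeDet]
    ring
  let ψ : StrongDual ℝ (Fin d → ℝ) := LinearMap.toContinuousLinearMap φ
  have hψproj : ∀ x, ψ ((canonicalFrame d).proj (1 + 1) x) = φ x := fun x => by
    change φ _ = φ x
    simp only [hφ, planeDet, canonicalFrame_proj_apply]
    simp
  have hψe : ψ (canonicalFrame d ⟨1, hd⟩) = c * (b - a) i₀ := by
    change φ _ = _
    rw [hφ, planeDet, canonicalFrame_apply]
    simp [hi₀]
  have hab : φ b = φ a := by
    rw [← sub_eq_zero, ← map_sub, hφ, planeDet]
    ring
  have hza : φ z < φ a := by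
    rw [← sub_neg, ← map_sub, hφ]
    exact hdet
  have hψ : ∀ x, x ∈ convexHull ℝ {a, b} ↔ x ∈ convexHull ℝ {a, b, z} ∧
      ∀ y ∈ convexHull ℝ {a, b, z}, ψ ((canonicalFrame d).proj (1 + 1) y) ≤
        ψ ((canonicalFrame d).proj (1 + 1) x) := by
    intro x
    simp only [hψproj]
    have h := mem_convexHull_argmax_iff id ({a, b, z} : Set (Fin d → ℝ)) φ (c := φ a) (by
      rintro y (rfl | rfl | rfl)
      · exact le_rfl
      · exact hab.le
      · exact hza.le) ⟨a, by simp, rfl⟩ x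
    have hset : ({y | y ∈ ({a, b, z} : Set (Fin d → ℝ)) ∧ φ (id y) = φ a}) = {a, b} := by
      ext y
      constructor
      · rintro ⟨rfl | rfl | rfl, h'⟩
        · simp
        · simp
        · exact absurd h' hza.ne
      · rintro (rfl | rfl)
        · exact ⟨by simp, rfl⟩
        · exact ⟨by simp, hab⟩
    rwa [hset, Set.image_id, Set.image_id] at h
  have hlin : lin (convexHull ℝ {a, b}) = Submodule.span ℝ {b - a} := by
    rw [lin, vectorSpan_convexHull, vectorSpan_pair_rev]
    rfl
  have main : c * (b - a) i₀ ≠ 0 → dim (convexHull ℝ {a, b}) = (1 : ℕ) ∧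
      ¬ convexHull ℝ {a, b, z} ⊆ convexHull ℝ {a, b} ∧
      Set.SurjOn ((canonicalFrame d).proj 1) (lin (convexHull ℝ {a, b}))
        ((canonicalFrame d).flag 1) := by
    intro h0
    have hx := right_ne_zero_of_mul h0
    refine ⟨?_, fun h => ?_, fun y hy => ?_⟩
    · rw [dim_of_nonempty ⟨a, subset_convexHull ℝ _ (by simp)⟩, hlin, finrank_span_singleton]
      intro h
      exact hx (by rw [h]; rfl)
    · have hz : z ∈ convexHull ℝ {a, b} := h (subset_convexHull ℝ _ (by simp))
      have ha : a ∈ convexHull ℝ {a, b, z} := subset_convexHull ℝ _ (by simp)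
      have := ((hψ z).1 hz).2 a ha
      rw [hψproj, hψproj] at this
      exact hza.not_ge this
    · refine ⟨(y i₀ / (b - a) i₀) • (b - a), ?_, ?_⟩
      · rw [hlin]
        exact Submodule.smul_mem _ _ (Submodule.mem_span_singleton_self _)
      · ext i
        rw [canonicalFrame_proj_apply]
        split_ifs with hi
        · have : i = i₀ := Fin.ext (by simpa using hi)
          rw [this, Pi.smul_apply, smul_eq_mul, div_mul_cancel₀ _ hx]
        · exact (mem_canonicalFrame_flag.1 hy i (not_lt.1 hi)).symm
  refine ⟨fun hneg => ?_, fun hpos => ?_⟩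
  · obtain ⟨h1, h2, h3⟩ := main hneg.ne
    exact mem_kSource_of_normal hd h1 h2 h3 hψ (hψe ▸ hneg)
  · obtain ⟨h1, h2, h3⟩ := main hpos.ne'
    exact mem_kTarget_of_normal hd h1 h2 h3 hψ (hψe ▸ hpos)

theorem two_le_finrank_lin_triangle (hd : 2 ≤ d) {a b z : Fin d → ℝ}
    (hdet : planeDet hd (b - a) (z - a) ≠ 0) :
    2 ≤ finrank ℝ (lin (convexHull ℝ {a, b, z})) := by
  have hli : LinearIndependent ℝ ![b - a, z - a] := by
    rw [LinearIndependent.pair_iff]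
    intro r s h
    have h0 := congrFun h ⟨0, by omega⟩
    have h1 := congrFun h ⟨1, by omega⟩
    simp only [Pi.add_apply, Pi.smul_apply, smul_eq_mul, Pi.zero_apply] at h0 h1
    refine ⟨?_, ?_⟩
    · refine (mul_eq_zero.1 (?_ : r * planeDet hd (b - a) (z - a) = 0)).resolve_right hdet
      rw [planeDet]
      linear_combination (z - a) ⟨1, by omega⟩ * h0 - (z - a) ⟨0, by omega⟩ * h1
    · refine (mul_eq_zero.1 (?_ : s * planeDet hd (b - a) (z - a) = 0)).resolve_right hdet
      rw [planeDet]
      linear_combination (b - a) ⟨0, by omega⟩ * h1 - (b - a) ⟨1, by omega⟩ * h0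
  have h1 : finrank ℝ (Submodule.span ℝ (Set.range ![b - a, z - a])) = 2 := by
    rw [finrank_span_eq_card hli]
    rfl
  rw [← h1]
  refine Submodule.finrank_mono (Submodule.span_le.2 ?_)
  rintro _ ⟨i, rfl⟩
  have ha : a ∈ convexHull ℝ {a, b, z} := subset_convexHull ℝ _ (by simp)
  have hb : b ∈ convexHull ℝ {a, b, z} := subset_convexHull ℝ _ (by simp)
  have hz : z ∈ convexHull ℝ {a, b, z} := subset_convexHull ℝ _ (by simp)
  fin_cases i
  · exact vsub_mem_vectorSpan ℝ hb ha
  · exact vsub_mem_vectorSpan ℝ hz ha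

/-- A closed zigzag of points in the plane, each one lying above the line through the two preceding
ones, produces a cellular `1`-loop. -/
theorem exists_cellularLoop_of_zigzag (hd : 2 ≤ d) {P : Set (Fin d → ℝ)} (z : ℕ → Fin d → ℝ)
    (hper : ∀ i, z (i + 6) = z i)
    (hface : ∀ i, IsFace P (convexHull ℝ {z i, z (i + 1), z (i + 2)}))
    (hx : ∀ i, 0 < (-1) ^ i * (z (i + 1) - z i) ⟨0, by omega⟩)
    (hdet : ∀ i, 0 < (-1) ^ i * planeDet hd (z (i + 1) - z i) (z (i + 2) - z i)) :
    ∃ (k m : ℕ) (F : Fin m → Set (Fin d → ℝ)), (canonicalFrame d).IsCellularLoop k P F := by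
  -- Six triangles, with the first repeated at position `6`; consecutive ones share the edge from `z
  -- (i + 1)` to `z (i + 2)`.
  refine ⟨1, 7, fun i => convexHull ℝ {z i, z (i + 1), z (i + 2)}, ⟨fun i => ⟨hface i, ?_⟩, ?_⟩,
    0, 6, by decide, ?_⟩
  · rw [dim_of_nonempty (by simp)]
    have := two_le_finrank_lin_triangle hd (right_ne_zero_of_mul (hdet i).ne')
    exact_mod_cast this
  · rintro ⟨i, _⟩ ⟨_, _⟩ rfl
    refine ⟨convexHull ℝ {z (i + 1), z (i + 2)}, ?_, ?_⟩
    · have h : ({z i, z (i + 1), z (i + 2)} : Set (Fin d → ℝ)) =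
          {z (i + 1), z (i + 2), z i} := by
        rw [Set.insert_comm, Set.pair_comm]
      change _ ∈ (canonicalFrame d).kTarget 1 (convexHull ℝ {z i, z (i + 1), z (i + 2)})
      rw [h]
      refine (edge_mem_kSource_or_kTarget hd (c := (-1) ^ (i + 1)) ?_).2 (hx (i + 1))
      have h1 : planeDet hd (z (i + 2) - z (i + 1)) (z i - z (i + 1)) =
          planeDet hd (z (i + 1) - z i) (z (i + 2) - z i) := by
        simp only [planeDet, Pi.sub_apply]
        ring
      rw [h1, pow_succ]
      linarith [hdet i]
    · refine (edge_mem_kSource_or_kTarget hd (c := -(-1) ^ (i + 1)) ?_).1 ?_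
      · linarith [hdet (i + 1)]
      · linarith [hx (i + 1)]
  · change convexHull ℝ {z 0, z 1, z 2} = convexHull ℝ {z (0 + 6), z (1 + 6), z (2 + 6)}
    rw [hper, hper, hper]

end PlaneLoops

/-! ### A zigzag hexagon satisfying prescribed linear relations -/

section Configuration

open Polynomial

/-- The signs of the affine dependence between the vertices of the zigzag hexagon. -/
def zigzagSign : Fin 6 → ℤ := ![1, 1, -1, -1, 1, -1]

/-- A planar hexagon, given by its coordinates, that spirals upwards: each vertex lies above the line
through the preceding two. -/
def IsZigzag (x y : Fin 6 → ℝ) : Prop :=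
  ∀ i : Fin 6, 0 < (-1) ^ i.val * (x (i + 1) - x i) ∧
    0 < (-1) ^ i.val * ((x (i + 1) - x i) * (y (i + 2) - y i) - (y (i + 1) - y i) * (x (i + 2) - x i))

theorem exists_isZigzag {b : Fin 6 → ℝ} (hb : ∀ i, 0 < b i) (h54 : b 5 < b 4) :
    ∃ x y : Fin 6 → ℝ, IsZigzag x y ∧ ∑ i, zigzagSign i * b i * x i = 0 ∧
      ∑ i, zigzagSign i * b i * y i = 0 := by
  have h0 := hb 0
  have h1 := hb 1
  have h2 := hb 2
  have h3 := hb 3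
  have h4 := hb 4
  have h5 := hb 5
  have h45 : 0 < b 4 - b 5 := sub_pos.2 h54
  -- For the hexagon `(-3,-3), (-2,0), (-C,C), (D,-D), (r+1,r-1), (B,B)`, the sum and difference of
  -- the two relations determine `r` from `B` and `D` from `C`. Taking `B` large gives `r + 1 < B`,
  -- which is where `b 5 < b 4` enters; taking `C` large gives `2 < C` and `r + 1 < D`.
  obtain ⟨B, hB⟩ : ∃ B, B = (3 * b 0 + b 1 + b 4) / (b 4 - b 5) + 1 := ⟨_, rfl⟩
  obtain ⟨r, hr⟩ : ∃ r, r = (3 * b 0 + b 5 * B + b 1) / b 4 := ⟨_, rfl⟩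
  obtain ⟨C, hC⟩ : ∃ C, C = 3 + b 3 * (r + 1) / b 2 + b 1 / b 2 := ⟨_, rfl⟩
  obtain ⟨D, hD⟩ : ∃ D, D = (b 2 * C + b 4 - b 1) / b 3 := ⟨_, rfl⟩
  have hBpos : 0 < B := by rw [hB]; positivity
  have hrpos : 0 < r := by rw [hr]; positivity
  have hCgt : 2 < C := by
    have : 0 ≤ b 3 * (r + 1) / b 2 + b 1 / b 2 := by positivity
    linarith
  have hr' : b 4 * r = 3 * b 0 + b 5 * B + b 1 := by rw [hr]; field_simp
  have hB' : (b 4 - b 5) * B = 3 * b 0 + b 1 + b 4 + (b 4 - b 5) := by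
    rw [hB]; field_simp
  have hD' : b 3 * D = b 2 * C + b 4 - b 1 := by rw [hD]; field_simp
  have hC' : b 2 * C = 3 * b 2 + b 3 * (r + 1) + b 1 := by rw [hC]; field_simp
  have hrB : r + 1 < B := by
    refine lt_of_mul_lt_mul_left ?_ h4.le
    nlinarith
  have hrD : r + 1 < D := by
    refine lt_of_mul_lt_mul_left ?_ h3.le
    nlinarith
  refine ⟨![-3, -2, -C, D, r + 1, B], ![-3, 0, C, -D, r - 1, B], ?_, ?_, ?_⟩
  · intro i
    fin_cases i
    · change 0 < (-1 : ℝ) ^ 0 * ((-2) - (-3)) ∧ 0 < (-1 : ℝ) ^ 0 *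
        (((-2) - (-3)) * (C - (-3)) - (0 - (-3)) * ((-C) - (-3)))
      constructor <;> nlinarith
    · change 0 < (-1 : ℝ) ^ 1 * ((-C) - (-2)) ∧ 0 < (-1 : ℝ) ^ 1 *
        (((-C) - (-2)) * ((-D) - 0) - (C - 0) * (D - (-2)))
      constructor <;> nlinarith
    · change 0 < (-1 : ℝ) ^ 2 * (D - (-C)) ∧ 0 < (-1 : ℝ) ^ 2 *
        ((D - (-C)) * ((r - 1) - C) - ((-D) - C) * ((r + 1) - (-C)))
      constructor <;> nlinarith
    · change 0 < (-1 : ℝ) ^ 3 * ((r + 1) - D) ∧ 0 < (-1 : ℝ) ^ 3 *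
        (((r + 1) - D) * (B - (-D)) - ((r - 1) - (-D)) * (B - D))
      constructor <;> nlinarith
    · change 0 < (-1 : ℝ) ^ 4 * (B - (r + 1)) ∧ 0 < (-1 : ℝ) ^ 4 *
        ((B - (r + 1)) * ((-3) - (r - 1)) - (B - (r - 1)) * ((-3) - (r + 1)))
      constructor <;> nlinarith
    · change 0 < (-1 : ℝ) ^ 5 * ((-3) - B) ∧ 0 < (-1 : ℝ) ^ 5 *
        (((-3) - B) * (0 - B) - ((-3) - B) * ((-2) - B))
      constructor <;> nlinarith
  · simp [Fin.sum_univ_succ, zigzagSign]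
    linarith
  · simp [Fin.sum_univ_succ, zigzagSign]
    linarith

end Configuration

/-! ### Realizing the hexagon by quartics and perturbing -/

section Realization

open Polynomial Topology Filter

/-- The product of the differences between a node and the other nodes. -/
def nodeProduct (t : Fin 6 → ℝ) (i : Fin 6) : ℝ := ∏ j ∈ Finset.univ.erase i, (t i - t j)

theorem inv_nodeProduct {t : Fin 6 → ℝ} (ht : StrictMono t) (i : Fin 6) :
    0 < |nodeProduct t i|⁻¹ ∧
      (nodeProduct t i)⁻¹ = -(-1) ^ i.val * |nodeProduct t i|⁻¹ := by
  have h := signVector_mul_prod_pos ht (Finset.notMem_erase i Finset.univ)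
  have hs : ∀ i : Fin 6, signVector (Finset.univ.erase i) i = -(-1) ^ i.val := by decide
  rw [hs] at h
  push_cast at h
  change 0 < -(-1) ^ i.val * nodeProduct t i at h
  have hne := right_ne_zero_of_mul h.ne'
  refine ⟨inv_pos.2 (abs_pos.2 hne), ?_⟩
  rcases neg_one_pow_eq_or ℝ i.val with h1 | h1 <;> rw [h1] at h ⊢
  · rw [abs_of_neg (by linarith), inv_neg]
    ring
  · rw [abs_of_pos (by linarith)]
    ring

/-- Both products contain the distance `t 5 - t 4`; each other node is farther from `t 5` than from
`t 4`. -/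
theorem inv_abs_nodeProduct_five_lt {t : Fin 6 → ℝ} (ht : StrictMono t) :
    |nodeProduct t 5|⁻¹ < |nodeProduct t 4|⁻¹ := by
  have hlt : ∀ i j : Fin 6, i < j → 0 < t j - t i := fun i j h => sub_pos.2 (ht h)
  have h5 : nodeProduct t 5 =
      (t 5 - t 0) * (t 5 - t 1) * (t 5 - t 2) * (t 5 - t 3) * (t 5 - t 4) := by
    rw [nodeProduct, show Finset.univ.erase (5 : Fin 6) = {0, 1, 2, 3, 4} by decide]
    simp [mul_assoc]
  have h4 : nodeProduct t 4 =
      -((t 4 - t 0) * (t 4 - t 1) * (t 4 - t 2) * (t 4 - t 3) * (t 5 - t 4)) := by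
    rw [nodeProduct, show Finset.univ.erase (4 : Fin 6) = {0, 1, 2, 3, 5} by decide]
    simp
    ring
  have h54 := hlt 4 5 (by decide)
  have h40 := hlt 0 4 (by decide)
  have h41 := hlt 1 4 (by decide)
  have h42 := hlt 2 4 (by decide)
  have h43 := hlt 3 4 (by decide)
  have h50 := hlt 0 5 (by decide)
  have h51 := hlt 1 5 (by decide)
  have h52 := hlt 2 5 (by decide)
  have h53 := hlt 3 5 (by decide)
  rw [h5, h4, abs_neg, abs_of_pos (by positivity), abs_of_pos (by positivity)]
  refine inv_strictAnti₀ (by positivity) ?_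
  gcongr <;> linarith

/-- Values at six nodes with vanishing fifth divided difference come from a quartic. -/
theorem exists_quartic {t : Fin 6 → ℝ} (ht : Function.Injective t) {z : Fin 6 → ℝ}
    (hz : ∑ i, z i / nodeProduct t i = 0) :
    ∃ f : ℝ[X], f.natDegree ≤ 4 ∧ ∀ i, f.eval (t i) = z i := by
  refine ⟨Lagrange.interpolate Finset.univ t z, ?_, fun i =>
    Lagrange.eval_interpolate_at_node z ht.injOn (Finset.mem_univ i)⟩
  have hdeg := Lagrange.degree_interpolate_lt z (s := Finset.univ) (v := t) ht.injOn
  have hcoeff := Lagrange.coeff_eq_sum (s := Finset.univ) (v := t) ht.injOn hdeg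
  simp only [Lagrange.eval_interpolate_at_node z ht.injOn (Finset.mem_univ _)] at hcoeff
  -- The top coefficient of the quintic interpolant is the fifth divided difference.
  have h5 : (Lagrange.interpolate Finset.univ t z).coeff 5 = 0 := hcoeff.trans hz
  rw [natDegree_le_iff_coeff_eq_zero]
  intro N hN
  rcases (show 5 ≤ N from hN).eq_or_lt with rfl | hN
  · exact h5
  · refine coeff_eq_zero_of_degree_lt (hdeg.trans_le ?_)
    have h6 : 6 ≤ N := hN
    simpa using h6

/-- Divided-difference weights alternate in sign along the nodes. A labelling `v` whose parities
match `zigzagSign` up to a global sign `τ` therefore turns the relations of `exists_isZigzag` into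
vanishing divided differences. -/
theorem exists_quartics_isZigzag {t : Fin 6 → ℝ} (ht : StrictMono t) (v : Equiv.Perm (Fin 6))
    (τ : ℤ) (hv : ∀ i, (-1) ^ (v i).val = τ * zigzagSign i)
    (hlt : |nodeProduct t (v 5)|⁻¹ < |nodeProduct t (v 4)|⁻¹) :
    ∃ f g : ℝ[X], f.natDegree ≤ 4 ∧ g.natDegree ≤ 4 ∧
      IsZigzag (fun i => f.eval (t (v i))) (fun i => g.eval (t (v i))) := by
  obtain ⟨x, y, hxy, hx, hy⟩ := exists_isZigzag (b := fun i => |nodeProduct t (v i)|⁻¹)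
    (fun i => (inv_nodeProduct ht (v i)).1) hlt
  have key : ∀ x : Fin 6 → ℝ, ∑ i, zigzagSign i * |nodeProduct t (v i)|⁻¹ * x i = 0 →
      ∑ i, (x ∘ v.symm) i / nodeProduct t i = 0 := by
    intro x hx
    rw [← Equiv.sum_comp v]
    have : ∀ i, (x ∘ v.symm) (v i) / nodeProduct t (v i) =
        -(τ : ℝ) * (zigzagSign i * |nodeProduct t (v i)|⁻¹ * x i) := by
      intro i
      have h : ((-1 : ℝ)) ^ (v i).val = τ * zigzagSign i := by exact_mod_cast hv i
      rw [div_eq_mul_inv, (inv_nodeProduct ht (v i)).2, h, Function.comp_apply,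
        Equiv.symm_apply_apply]
      ring
    rw [Finset.sum_congr rfl fun i _ => this i, ← Finset.mul_sum, hx, mul_zero]
  obtain ⟨f, hf, hfx⟩ := exists_quartic ht.injective (key x hx)
  obtain ⟨g, hg, hgy⟩ := exists_quartic ht.injective (key y hy)
  refine ⟨f, g, hf, hg, ?_⟩
  simpa [hfx, hgy] using hxy

/-- With `w i` the inverse absolute node product, the three labellings need `w 3 < w 4`, `w 2 < w 3`
and `w 5 < w 2` respectively. If the first two fail, then `w 5 < w 4 ≤ w 3 ≤ w 2` gives the third.
-/
theorem exists_isZigzag_hexagon {t : Fin 6 → ℝ} (ht : StrictMono t) :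
    ∃ v : Fin 6 → Fin 6, (∀ i, HasConsecutive (v i) (v (i + 1)) (v (i + 2))) ∧
      ∃ f g : ℝ[X], f.natDegree ≤ 4 ∧ g.natDegree ≤ 4 ∧
        IsZigzag (fun i => f.eval (t (v i))) (fun i => g.eval (t (v i))) := by
  by_cases h1 : |nodeProduct t 3|⁻¹ < |nodeProduct t 4|⁻¹
  · let v : Equiv.Perm (Fin 6) :=
      ⟨![0, 2, 1, 5, 4, 3], ![0, 2, 1, 5, 4, 3], by decide, by decide⟩
    exact ⟨v, by decide, exists_quartics_isZigzag ht v 1 (by decide) h1⟩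
  by_cases h2 : |nodeProduct t 2|⁻¹ < |nodeProduct t 3|⁻¹
  · let v : Equiv.Perm (Fin 6) :=
      ⟨![5, 1, 4, 0, 3, 2], ![3, 1, 5, 4, 2, 0], by decide, by decide⟩
    exact ⟨v, by decide, exists_quartics_isZigzag ht v (-1) (by decide) h2⟩
  · let v : Equiv.Perm (Fin 6) :=
      ⟨![4, 0, 1, 3, 2, 5], ![1, 2, 4, 3, 0, 5], by decide, by decide⟩
    exact ⟨v, by decide, exists_quartics_isZigzag ht v 1 (by decide)
      ((inv_abs_nodeProduct_five_lt ht).trans_le ((not_lt.1 h1).trans (not_lt.1 h2)))⟩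

theorem eventually_isZigzag {x y a b : Fin 6 → ℝ} (h : IsZigzag x y) :
    ∀ᶠ s : ℝ in 𝓝 0, IsZigzag (fun i => x i + s * a i) (fun i => y i + s * b i) := by
  refine eventually_all.2 fun i => ?_
  have hpos : ∀ F : ℝ → ℝ, Continuous F → 0 < F 0 → ∀ᶠ s in 𝓝 0, 0 < F s := fun F hF h0 =>
    hF.continuousAt.eventually (lt_mem_nhds h0)
  refine (hpos _ (by fun_prop) ?_).and (hpos _ (by fun_prop) ?_)
  · simpa using (h i).1
  · simpa using (h i).2

theorem exists_framed_cyclic_with_loop {d n : ℕ} (hd : 4 ≤ d) (hn : 6 ≤ n) {t : Fin n → ℝ}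
    (ht : StrictMono t) :
    ∃ P : Set (Fin d → ℝ), CombinatoriallyEquivalent P (cyclicPolytope d t) ∧
      (canonicalFrame d).Frames P ∧
      ∃ (k m : ℕ) (F : Fin m → Set (Fin d → ℝ)), (canonicalFrame d).IsCellularLoop k P F := by
  have hd2 : 2 ≤ d := by omega
  let c : Fin 6 → Fin n := Fin.castLE hn
  have htc : StrictMono (t ∘ c) := ht.comp (Fin.strictMono_castLE hn)
  obtain ⟨v, hcons, f, g, hf, hg, hz⟩ := exists_isZigzag_hexagon htc
  set e₀ : Fin d → ℝ := Pi.single ⟨0, by omega⟩ 1 with he₀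
  set e₁ : Fin d → ℝ := Pi.single ⟨1, by omega⟩ 1 with he₁
  let M : (Fin d → ℝ) →ₗ[ℝ] (Fin d → ℝ) := (polynomialFunctional d f).smulRight e₀ +
    (polynomialFunctional d g).smulRight e₁
  -- The summand `s • id` adds `s` times the first two moment coordinates, `t` and `t ^ 2`, to the
  -- planar hexagon. The constant terms lost by `polynomialFunctional` cancel in differences.
  have hU := eventually_isZigzag (a := fun i => t (c (v i))) (b := fun i => t (c (v i)) ^ 2) hz
  obtain ⟨s, hs, L, hL, hadm⟩ := exists_generic_perturbation (d := d) ht.injective M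
    (infinite_of_mem_nhds (0 : ℝ) hU)
  rw [Set.mem_ofPred_eq] at hs
  let p : Fin n → Fin d → ℝ := fun i => L (momentCurve d (t i))
  have hp₀ : ∀ i, p i ⟨0, by omega⟩ = f.eval (t i) + s * t i - f.coeff 0 := by
    intro i
    simp only [p, hL, M, Pi.add_apply, Pi.smul_apply, LinearMap.add_apply,
      LinearMap.smulRight_apply, polynomialFunctional_momentCurve (hf.trans hd),
      polynomialFunctional_momentCurve (hg.trans hd), he₀, he₁]
    simp [momentCurve]
    ring
  have hp₁ : ∀ i, p i ⟨1, by omega⟩ = g.eval (t i) + s * t i ^ 2 - g.coeff 0 := by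
    intro i
    simp only [p, hL, M, Pi.add_apply, Pi.smul_apply, LinearMap.add_apply,
      LinearMap.smulRight_apply, polynomialFunctional_momentCurve (hf.trans hd),
      polynomialFunctional_momentCurve (hg.trans hd), he₀, he₁]
    simp [momentCurve]
    ring
  refine ⟨L '' cyclicPolytope d t, combinatoriallyEquivalent_image L _, ⟨?_, hadm⟩, ?_⟩
  · have : L '' cyclicPolytope d t = convexHull ℝ (Set.range p) := by
      rw [cyclicPolytope]
      change (L : (Fin d → ℝ) →ₗ[ℝ] (Fin d → ℝ)) '' _ = _
      rw [LinearMap.image_convexHull, ← Set.range_comp]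
      rfl
    rw [this]
    exact isPolytope_convexHull_range p
  · let r : ℕ → Fin 6 := Fin.ofNat 6
    have hr : ∀ i k : ℕ, r (i + k) = r i + r k := fun i k => Fin.ext (by simp [r, Fin.val_add])
    have hr1 : ∀ i, r (i + 1) = r i + 1 := fun i => hr i 1
    have hr2 : ∀ i, r (i + 2) = r i + 2 := fun i => hr i 2
    have hsign : ∀ i : ℕ, (-1 : ℝ) ^ i = (-1) ^ (r i).val := by
      intro i
      rw [show (r i).val = i % 6 from rfl, neg_one_pow_eq_pow_mod_two,
        neg_one_pow_eq_pow_mod_two (n := i % 6), Nat.mod_mod_of_dvd _ (by norm_num)]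
    refine exists_cellularLoop_of_zigzag hd2 (fun i => p (c (v (r i)))) ?_ ?_ ?_ ?_
    · intro i
      have : r (i + 6) = r i := (hr i 6).trans (add_zero _)
      simp only [this]
    · intro i
      have h := isFace_image L (isFace_cyclicPolytope_triangle ht hd (a := c (v (r i)))
        (b := c (v (r i + 1))) (c := c (v (r i + 2))) (hcons (r i)))
      have h2 : L '' convexHull ℝ ((fun i => momentCurve d (t i)) ''
          {c (v (r i)), c (v (r i + 1)), c (v (r i + 2))}) =
          convexHull ℝ {p (c (v (r i))), p (c (v (r i + 1))), p (c (v (r i + 2)))} := by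
        change (L : (Fin d → ℝ) →ₗ[ℝ] (Fin d → ℝ)) '' _ = _
        rw [LinearMap.image_convexHull, ← Set.image_comp, Set.image_insert_eq, Set.image_pair]
        rfl
      rw [h2] at h
      rw [hr1, hr2]
      exact h
    · intro i
      have h := (hs (r i)).1
      rw [hsign, Pi.sub_apply, hp₀, hp₀, hr1]
      convert h using 2
      simp only [Function.comp_apply]
      ring
    · intro i
      have h := (hs (r i)).2
      rw [hsign]
      simp only [hr2]
      simp only [planeDet, Pi.sub_apply, hp₀, hp₁, hr1]
      convert h using 2
      simp only [Function.comp_apply]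
      ring

end Realization

end FramedPolytope

theorem mainTheorem12 :
    (∀ d n : ℕ, 4 ≤ d → max 6 (d + 1) ≤ n → ∀ t : Fin n → ℝ, StrictMono t →
      ∃ P : Set (Fin d → ℝ),
        FramedPolytope.CombinatoriallyEquivalent P (FramedPolytope.cyclicPolytope d t) ∧
        (FramedPolytope.canonicalFrame d).Frames P ∧
        ∃ (k m : ℕ) (F : Fin m → Set (Fin d → ℝ)),
          (FramedPolytope.canonicalFrame d).IsCellularLoop k P F) ∧
    (∀ d n : ℕ, d < n → ∀ t : Fin n → ℝ, StrictMono t →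
      (FramedPolytope.canonicalFrame d).Frames (FramedPolytope.cyclicPolytope d t) ∧
      (FramedPolytope.canonicalFrame d).LoopFree (FramedPolytope.cyclicPolytope d t)) :=
  ⟨fun _ _ hd hn _ ht =>
    FramedPolytope.exists_framed_cyclic_with_loop hd ((le_max_left _ _).trans hn) ht,
  fun _ _ _ _ ht => ⟨FramedPolytope.cyclicPolytope_frames ht.injective,
    FramedPolytope.cyclicPolytope_loopFree ht⟩⟩
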